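/- **Conventions.** An *affine manifold* is a manifold with an atlas of charts in $\mathbb R^n$ whose transition maps are locally affine (equivalently, a manifold with a flat torsion-free connection). A map between affine manifolds is *affine* if it is continuous and locally affine in affine charts. A *geodesic* is a curve which in affine charts is locally of the form $s\mapsto a+sv$. An affine manifold is *geodesically complete* if every tangent vector is the initial velocity of a geodesic defined on all of $\mathbb R$. A diffeomorphism $f$ of $M$ is *Anosov*, with stable and unstable distributions $E^s,E^u\subset TM$, if $T_xM=E^s_x\oplus E^u_x$ for every $x\in M$ and there are a Riemannian metric on $M$ and constants $c,c'>0$, $0<\lambda<1$ with $$\|df^m(v)\|\le c\,\lambda^m\|v\|\ \ (v\in E^s),\qquad \|df^m(w)\|\ge c'\lambda^{-m}\|w\|\ \ (w\in E^u)$$ for all integers $m\ge 1$ (continuity and $df$-invariance of the distributions need not be assumed). The leaf through $x$ of the stable foliation $\mathcal F^s$ is the set of points that can be joined to $x$ by a $C^1$ curve everywhere tangent to $E^s$. **Proposition 1.2.** Let $M$ be a compact Hausdorff affine manifold of dimension $n$, let $f:M\to M$ be an affine Anosov diffeomorphism with stable distribution $E^s$, and let $L$ be a leaf of the stable foliation $\mathcal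 F^s$. Then $L$ carries an induced affine structure, that is, a (leaf) topology and an affine atlas for which the inclusion $L\to M$ is an affine immersion whose tangent space at each $y\in L$ is $E^s_y$; and for every such induced affine structure, $L$ is geodesically complete. -/

import Mathlib

open Set Filter Topology Manifold
open scoped ContDiff

namespace AffineAnosov

/-! ### Affine manifolds -/

section AffineManifolds

/-- The pregroupoid of locally affine self-maps of a normed space `E`. -/
def affinePregroupoid (E : Type*) [NormedAddCommGroup E] [NormedSpace ℝ E] :
    Pregroupoid E where
  property f u := ∀ x ∈ u, ∃ A : E →ᴬ[ℝ] E, ∀ᶠ y in 𝓝 x, f y = A y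
  comp := by
    rintro f g u v hf hg - - - x ⟨hxu, hxv⟩
    obtain ⟨A, hA⟩ := hf x hxu
    obtain ⟨B, hB⟩ := hg (f x) hxv
    refine ⟨B.comp A, ?_⟩
    have hcont : Tendsto A (𝓝 x) (𝓝 (f x)) := by
      rw [hA.self_of_nhds]
      exact A.continuous.tendsto x
    filter_upwards [hA, hcont.eventually hB] with y h1 h2
    simp only [Function.comp_apply, h1, h2, ContinuousAffineMap.comp_apply]
  id_mem := fun _ _ => ⟨ContinuousAffineMap.id ℝ E, by simp⟩
  locality := by
    intro f u _ h x hx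
    obtain ⟨v, _, hxv, hv⟩ := h x hx
    exact hv x ⟨hx, hxv⟩
  congr := by
    intro f g u hu hfg hf x hx
    obtain ⟨A, hA⟩ := hf x hx
    refine ⟨A, ?_⟩
    filter_upwards [hA, hu.mem_nhds hx] with y h1 h2
    rw [hfg y h2, h1]

/-- The groupoid of homeomorphisms between open subsets of `E` which are locally affine, as well
as their inverse. -/
def affineGroupoid (E : Type*) [NormedAddCommGroup E] [NormedSpace ℝ E] :
    StructureGroupoid E :=
  (affinePregroupoid E).groupoid

/-- An affine manifold modelled on `E`: the changes of charts of the atlas are locally affine. -/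
class AffineManifold (E : Type*) [NormedAddCommGroup E] [NormedSpace ℝ E]
    (M : Type*) [TopologicalSpace M] [ChartedSpace E M] : Prop
    extends HasGroupoid M (affineGroupoid E)

theorem affineGroupoid_le_contDiffGroupoid (E : Type*) [NormedAddCommGroup E]
    [NormedSpace ℝ E] (n : WithTop ℕ∞) :
    affineGroupoid E ≤ contDiffGroupoid n 𝓘(ℝ, E) := by
  refine groupoid_of_pregroupoid_le _ _ ?_
  intro f s hf
  simp only [contDiffPregroupoid, modelWithCornersSelf_coe, modelWithCornersSelf_coe_symm,
    Function.comp_id, Function.id_comp, range_id, inter_univ, preimage_id]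
  intro x hx
  obtain ⟨A, hA⟩ := hf x hx
  exact (A.contDiff.contDiffAt.congr_of_eventuallyEq hA).contDiffWithinAt

/-- An affine manifold is in particular a smooth manifold. -/
instance AffineManifold.isManifold (E : Type*) [NormedAddCommGroup E] [NormedSpace ℝ E]
    (M : Type*) [TopologicalSpace M] [ChartedSpace E M] [h : AffineManifold E M]
    (n : WithTop ℕ∞) : IsManifold 𝓘(ℝ, E) n M :=
  { hasGroupoid_of_le h.toHasGroupoid (affineGroupoid_le_contDiffGroupoid E n) with }

variable {E F : Type*} [NormedAddCommGroup E] [NormedSpace ℝ E]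
  [NormedAddCommGroup F] [NormedSpace ℝ F]
  {M N : Type*} [TopologicalSpace M] [ChartedSpace E M]
  [TopologicalSpace N] [ChartedSpace F N]

variable (E F) in
/-- A map between affine manifolds is affine if it is continuous and if, around each point, it is
an affine map when read in affine charts. -/
def IsAffineMap (f : M → N) : Prop :=
  Continuous f ∧ ∀ x : M, ∃ A : E →ᴬ[ℝ] F,
    ∀ᶠ y in 𝓝 x, chartAt F (f x) (f y) = A (chartAt E x y)

variable (E) in
/-- A geodesic `γ : ℝ → M` of the flat connection of an affine manifold: read in affine charts, it
is locally of the form `s ↦ a + s v`. (Constant curves are allowed.) -/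
def IsAffineGeodesic (γ : ℝ → M) : Prop :=
  Continuous γ ∧ ∀ t : ℝ, ∃ a v : E, ∀ᶠ s in 𝓝 t, chartAt E (γ t) (γ s) = a + s • v

variable (E) in
/-- The velocity vector of a (differentiable) curve, as a point of the tangent bundle. -/
noncomputable def velocity (γ : ℝ → M) (t : ℝ) : TangentBundle 𝓘(ℝ, E) M :=
  ⟨γ t, mfderiv 𝓘(ℝ, ℝ) 𝓘(ℝ, E) γ t (1 : ℝ)⟩

variable (E M) in
/-- Geodesic completeness of an affine manifold: every tangent vector is the initial velocity of a
geodesic which is defined for all times. -/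
def GeodesicallyComplete : Prop :=
  ∀ ξ : TangentBundle 𝓘(ℝ, E) M, ∃ γ : ℝ → M, IsAffineGeodesic E γ ∧ velocity E γ 0 = ξ

end AffineManifolds

/-! ### Anosov diffeomorphisms and their stable foliation -/

section Anosov

variable {E : Type*} [NormedAddCommGroup E] [NormedSpace ℝ E]
  {M : Type*} [TopologicalSpace M] [ChartedSpace E M]

/-- The norm on tangent vectors associated to a (smooth) Riemannian metric. -/
noncomputable def riemannianNorm [IsManifold 𝓘(ℝ, E) 1 M]
    (g : Bundle.ContMDiffRiemannianMetric 𝓘(ℝ, E) ∞ E (fun x : M => TangentSpace 𝓘(ℝ, E) x))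
    (x : M) (v : TangentSpace 𝓘(ℝ, E) x) : ℝ :=
  Real.sqrt (g.inner x v v)

/-- `Es`, `Eu` are the stable and unstable distributions of an Anosov diffeomorphism `f`: they are
supplementary in each tangent space and, for some Riemannian metric, the iterates of `df` contract
`Es` and expand `Eu` at a uniform exponential rate. The continuity of the distributions and their
invariance by `df` are not part of the requirements. -/
def IsAnosovSplitting [IsManifold 𝓘(ℝ, E) 1 M] (f : M → M)
    (Es Eu : ∀ x : M, Submodule ℝ (TangentSpace 𝓘(ℝ, E) x)) : Prop :=
  (∀ x, IsCompl (Es x) (Eu x)) ∧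
  ∃ g : Bundle.ContMDiffRiemannianMetric 𝓘(ℝ, E) ∞ E (fun x : M => TangentSpace 𝓘(ℝ, E) x),
  ∃ c c' l : ℝ, 0 < c ∧ 0 < c' ∧ 0 < l ∧ l < 1 ∧
    (∀ m : ℕ, 0 < m → ∀ (x : M), ∀ v ∈ Es x,
      riemannianNorm g (f^[m] x) (mfderiv 𝓘(ℝ, E) 𝓘(ℝ, E) f^[m] x v)
        ≤ c * l ^ m * riemannianNorm g x v) ∧
    (∀ m : ℕ, 0 < m → ∀ (x : M), ∀ w ∈ Eu x,
      c' * (l⁻¹) ^ m * riemannianNorm g x w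
        ≤ riemannianNorm g (f^[m] x) (mfderiv 𝓘(ℝ, E) 𝓘(ℝ, E) f^[m] x w))

/-- `x` and `y` are joined by a `C^1` curve which is everywhere tangent to the distribution `D`.
(The velocity may vanish, so this is an equivalence relation and it would be the same to use
piecewise `C^1` curves parametrized by `[0, 1]`.) -/
def JoinedTangentially (D : ∀ x : M, Submodule ℝ (TangentSpace 𝓘(ℝ, E) x)) (x y : M) : Prop :=
  ∃ γ : ℝ → M, ContMDiff 𝓘(ℝ, ℝ) 𝓘(ℝ, E) 1 γ ∧
    (∀ t, (velocity E γ t).2 ∈ D (velocity E γ t).1) ∧ γ 0 = x ∧ γ 1 = y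

/-- The leaf through `x` of the foliation tangent to the distribution `D`, as a bare type: it does
not carry the topology induced by `M`. -/
def Leaf (D : ∀ x : M, Submodule ℝ (TangentSpace 𝓘(ℝ, E) x)) (x : M) : Type _ :=
  {y : M // JoinedTangentially D x y}

/-- The inclusion of a leaf in the ambient manifold. -/
def Leaf.incl (D : ∀ x : M, Submodule ℝ (TangentSpace 𝓘(ℝ, E) x)) (x : M) : Leaf D x → M :=
  fun y => y.1

/-- The dimension of the leaf through `x` of the foliation tangent to `D`. -/
noncomputable abbrev leafDim (D : ∀ x : M, Submodule ℝ (TangentSpace 𝓘(ℝ, E) x)) (x : M) : ℕ :=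
  Module.finrank ℝ (D x)

/-- An affine structure on the leaf through `x` of the foliation tangent to `D` (leaf topology and
affine atlas) is induced by the affine structure of `M` if the inclusion of the leaf is an affine
immersion, and the tangent space of the leaf at each point `y` is `D y`. -/
structure InducedAffineStructure (D : ∀ x : M, Submodule ℝ (TangentSpace 𝓘(ℝ, E) x)) (x : M) where
  [top : TopologicalSpace (Leaf D x)]
  [charted : ChartedSpace (EuclideanSpace ℝ (Fin (leafDim D x))) (Leaf D x)]
  [affine : AffineManifold (EuclideanSpace ℝ (Fin (leafDim D x))) (Leaf D x)]
  isAffineMap_incl : IsAffineMap (EuclideanSpace ℝ (Fin (leafDim D x))) E (Leaf.incl D x)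
  injective_mfderiv : ∀ y : Leaf D x, Function.Injective
    (mfderiv 𝓘(ℝ, EuclideanSpace ℝ (Fin (leafDim D x))) 𝓘(ℝ, E) (Leaf.incl D x) y)
  range_mfderiv : ∀ y : Leaf D x,
    (mfderiv 𝓘(ℝ, EuclideanSpace ℝ (Fin (leafDim D x))) 𝓘(ℝ, E) (Leaf.incl D x) y).range
      = D (Leaf.incl D x y)

/-- The leaf, with the given induced affine structure, is geodesically complete. -/
def InducedAffineStructure.IsComplete
    {D : ∀ x : M, Submodule ℝ (TangentSpace 𝓘(ℝ, E) x)} {x : M}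
    (S : InducedAffineStructure D x) : Prop :=
  letI := S.top
  letI := S.charted
  GeodesicallyComplete (EuclideanSpace ℝ (Fin (leafDim D x))) (Leaf D x)

end Anosov

end AffineAnosov

/-! The leaf through `x` is the image of an injective affine immersion `Ψ` of a whole vector space;
its straight lines then supply complete geodesics.

By compactness, every point of `M` is the center of an affine chart ball of a fixed radius `r` on
which the Riemannian norm and the chart norm are comparable up to a fixed constant `C`. Let `L m` be
the linear part of `f^[m]` at `x` in these charts. Pulling back the chart ball at `f^[m] x` by the
affine map `f.symm^[m]` gives an injective affine parametrization `pullbackExp` of a neighborhood of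
`x` by the ellipsoid `‖L m v‖ < r`. All these parametrizations have the same germ at `0`, and any
two ellipsoids meet in a convex set, so the identity theorem for affine maps makes them agree on
overlaps (`pullbackExp_eventuallyEq`).

Stable vectors are exactly those whose images under the iterates of `df` stay bounded
(`IsAnosovSplittingWith.mem_iff_bounded`). Read through `pullbackExp`, this identifies the stable
directions, at all the points concerned, with a single subspace `K` of `E`, the vectors `a` for
which `L m a` is eventually bounded. On `K` one even has `L m a → 0`, so each vector of `K` lies in
all ellipsoids of large index, and the parametrizations glue to `Ψ` on `K`, tangent to the stable
distribution.

Conversely, `f^[m]` contracts a curve from `x` tangent to `Es` until it fits in a single chart ball.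
It therefore lifts through `pullbackExp` for all large `m`. These lifts coincide, so their common
endpoint has bounded images under the `L m` and belongs to `K`
(`exists_pullbackExp_eq_of_joinedTangentially`). Hence the leaf is exactly the image of `Ψ`.

Transporting the affine structure of the vector space by `Ψ` gives existence. For an arbitrary
induced structure, the inclusion and `Ψ` are affine with the same image and the same tangent spaces,
so lines lift to geodesics (`lift_line`). -/

namespace AffineAnosov

/-! ### Germs of affine maps: calculus, identity theorem, uniqueness of lifts -/

section LocallyAffine

variable (E F : Type*) [NormedAddCommGroup E] [NormedSpace ℝ E]
  [NormedAddCommGroup F] [NormedSpace ℝ F]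
  {M N : Type*} [TopologicalSpace M] [ChartedSpace E M]
  [TopologicalSpace N] [ChartedSpace F N]

/-- A map is affine at a point if it is continuous there and agrees, near this point and in the
preferred charts, with an affine map. -/
def IsAffineAt (h : M → N) (x : M) : Prop :=
  ContinuousAt h x ∧ ∃ A : E →ᴬ[ℝ] F,
    ∀ᶠ y in 𝓝 x, chartAt F (h x) (h y) = A (chartAt E x y)

variable {E F}

theorem IsAffineMap.isAffineAt {h : M → N} (hh : IsAffineMap E F h) (x : M) :
    IsAffineAt E F h x :=
  ⟨hh.1.continuousAt, hh.2 x⟩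

theorem isAffineMap_of_forall_isAffineAt {h : M → N} (hh : ∀ x, IsAffineAt E F h x) :
    IsAffineMap E F h :=
  ⟨continuous_iff_continuousAt.2 fun x => (hh x).1, fun x => (hh x).2⟩

theorem IsAffineAt.comp {G : Type*} [NormedAddCommGroup G] [NormedSpace ℝ G]
    {P : Type*} [TopologicalSpace P] [ChartedSpace G P] {k : N → P} {h : M → N} {x : M}
    (hk : IsAffineAt F G k (h x)) (hh : IsAffineAt E F h x) :
    IsAffineAt E G (fun y => k (h y)) x := by
  obtain ⟨hk, B, hB⟩ := hk
  obtain ⟨hh, A, hA⟩ := hh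
  refine ⟨hk.comp hh, B.comp A, ?_⟩
  filter_upwards [hA, hh.eventually hB] with y h1 h2
  rw [ContinuousAffineMap.comp_apply, ← h1, h2]

theorem IsAffineAt.comp_of_eq {G : Type*} [NormedAddCommGroup G] [NormedSpace ℝ G]
    {P : Type*} [TopologicalSpace P] [ChartedSpace G P] {k : N → P} {h : M → N} {x : M} {z : N}
    (hk : IsAffineAt F G k z) (hh : IsAffineAt E F h x) (hz : h x = z) :
    IsAffineAt E G (fun y => k (h y)) x := by
  subst hz
  exact hk.comp hh

theorem IsAffineAt.congr {h k : M → N} {x : M} (hh : IsAffineAt E F h x) (hk : k =ᶠ[𝓝 x] h) :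
    IsAffineAt E F k x := by
  obtain ⟨hh, A, hA⟩ := hh
  refine ⟨hh.congr hk.symm, A, ?_⟩
  filter_upwards [hA, hk] with y h1 h2
  rw [h2, hk.self_of_nhds, h1]

theorem ContinuousAffineMap.isAffineAt (A : E →ᴬ[ℝ] F) (x : E) : IsAffineAt E F A x :=
  ⟨A.continuous.continuousAt, A, Eventually.of_forall fun _ => rfl⟩

theorem IsAffineAt.exists_eventuallyEq {h : E → F} {x : E} (hh : IsAffineAt E F h x) :
    ∃ A : E →ᴬ[ℝ] F, ∀ᶠ y in 𝓝 x, h y = A y :=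
  hh.2

theorem isAffineAt_id (x : M) : IsAffineAt E E (fun y : M => y) x :=
  ⟨continuousAt_id, ContinuousAffineMap.id ℝ E, by simp⟩

theorem isAffineAt_chartAt [AffineManifold E M] {p x : M} (hx : x ∈ (chartAt E p).source) :
    IsAffineAt E E (chartAt E p) x := by
  refine ⟨(chartAt E p).continuousAt hx, ?_⟩
  have h := (HasGroupoid.compatible (G := affineGroupoid E) (chart_mem_atlas E x)
    (chart_mem_atlas E p))
  have h1 := (mem_groupoid_of_pregroupoid.1 h).1
  obtain ⟨A, hA⟩ := h1 (chartAt E x x) (by simp [hx])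
  refine ⟨A, ?_⟩
  have hc := ((chartAt E x).continuousAt (mem_chart_source E x)).eventually hA
  filter_upwards [hc, (chartAt E x).open_source.mem_nhds (mem_chart_source E x)] with y h2 h3
  simp only [Function.comp_apply, OpenPartialHomeomorph.coe_trans, (chartAt E x).left_inv h3] at h2
  exact h2

theorem isAffineAt_chartAt_symm [AffineManifold E M] {p : M} {u : E}
    (hu : u ∈ (chartAt E p).target) : IsAffineAt E E (chartAt E p).symm u := by
  refine ⟨(chartAt E p).continuousAt_symm hu, ?_⟩
  set x := (chartAt E p).symm u
  have h := (HasGroupoid.compatible (G := affineGroupoid E) (chart_mem_atlas E p)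
    (chart_mem_atlas E x))
  have h1 := (mem_groupoid_of_pregroupoid.1 h).1
  obtain ⟨A, hA⟩ := h1 u (by simp [hu, x])
  exact ⟨A, hA⟩

theorem IsAffineAt.hasMFDerivAt {h : M → N} {x : M} {A : E →ᴬ[ℝ] F}
    (hc : ContinuousAt h x)
    (hA : ∀ᶠ y in 𝓝 x, chartAt F (h x) (h y) = A (chartAt E x y)) :
    HasMFDerivAt 𝓘(ℝ, E) 𝓘(ℝ, F) h x A.contLinear := by
  refine ⟨hc, ?_⟩
  have h1 : HasFDerivAt A A.contLinear (chartAt E x x) := by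
    rw [hasFDerivAt_iff_isLittleO_nhds_zero]
    have : ∀ v, A (chartAt E x x + v) - A (chartAt E x x) - A.contLinear v = 0 := by
      intro v
      have := A.contLinear_map_vsub (chartAt E x x + v) (chartAt E x x)
      simp only [vsub_eq_sub, add_sub_cancel_left] at this
      rw [this, sub_self]
    simp only [this]
    exact Asymptotics.isLittleO_zero _ _
  have h2 : HasFDerivAt (writtenInExtChartAt 𝓘(ℝ, E) 𝓘(ℝ, F) x h) A.contLinear
      (chartAt E x x) := by
    refine h1.congr_of_eventuallyEq ?_
    have hs : ContinuousAt (chartAt E x).symm (chartAt E x x) :=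
      (chartAt E x).continuousAt_symm (mem_chart_target E x)
    have hs' := hs.tendsto
    rw [(chartAt E x).left_inv (mem_chart_source E x)] at hs'
    filter_upwards [hs'.eventually hA, (chartAt E x).open_target.mem_nhds (mem_chart_target E x)]
      with v h3 h4
    simpa [writtenInExtChartAt, (chartAt E x).right_inv h4] using h3
  exact h2.hasFDerivWithinAt

theorem IsAffineAt.mdifferentiableAt {h : M → N} {x : M} (hh : IsAffineAt E F h x) :
    MDifferentiableAt 𝓘(ℝ, E) 𝓘(ℝ, F) h x := by
  obtain ⟨hc, A, hA⟩ := hh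
  exact (IsAffineAt.hasMFDerivAt hc hA).mdifferentiableAt

theorem IsAffineAt.contMDiffAt {h : M → N} {x : M} (hh : IsAffineAt E F h x)
    (n : WithTop ℕ∞) : ContMDiffAt 𝓘(ℝ, E) 𝓘(ℝ, F) n h x := by
  obtain ⟨hc, A, hA⟩ := hh
  rw [contMDiffAt_iff]
  refine ⟨hc, ?_⟩
  have hs : ContinuousAt (chartAt E x).symm (chartAt E x x) :=
      (chartAt E x).continuousAt_symm (mem_chart_target E x)
  have hs' := hs.tendsto
  rw [(chartAt E x).left_inv (mem_chart_source E x)] at hs'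
  have : ContDiffAt ℝ n (fun v => chartAt F (h x) (h ((chartAt E x).symm v))) (chartAt E x x) := by
    refine A.contDiff.contDiffAt.congr_of_eventuallyEq ?_
    filter_upwards [hs'.eventually hA, (chartAt E x).open_target.mem_nhds (mem_chart_target E x)]
      with v h3 h4
    simpa [(chartAt E x).right_inv h4] using h3
  exact this.contDiffWithinAt

/-- The germ at `x` determines the value at `x` and, as the derivative there, the linear part. -/
theorem ContinuousAffineMap.eq_of_eventuallyEq {A B : E →ᴬ[ℝ] F} {x : E}
    (h : ∀ᶠ y in 𝓝 x, A y = B y) : A = B := by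
  have h1 : HasMFDerivAt 𝓘(ℝ, E) 𝓘(ℝ, F) A x A.contLinear :=
    IsAffineAt.hasMFDerivAt A.continuous.continuousAt (Eventually.of_forall fun _ => rfl)
  have h2 : HasMFDerivAt 𝓘(ℝ, E) 𝓘(ℝ, F) A x B.contLinear :=
    IsAffineAt.hasMFDerivAt A.continuous.continuousAt h
  have h3 : A.contLinear = B.contLinear := hasMFDerivAt_unique h1 h2
  ext y
  have hA := A.contLinear_map_vsub y x
  have hB := B.contLinear_map_vsub y x
  rw [h3, hB] at hA
  simp only [vsub_eq_sub, h.self_of_nhds] at hA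
  exact (sub_left_injective hA).symm

theorem ContinuousAffineMap.map_add_eq (A : E →ᴬ[ℝ] F) (x v : E) :
    A (x + v) = A x + A.contLinear v := by
  have := A.contLinear_map_vsub (x + v) x
  simp only [vsub_eq_sub, add_sub_cancel_left] at this
  rw [this, add_sub_cancel]

/-- Two maps which are affine at a point, and agree at points arbitrarily close to it in the sense
of germs, have the same germ. -/
theorem IsAffineAt.eventuallyEq_of_mem_closure [T2Space N] {G₁ G₂ : E → N} {u : E}
    (h₁ : IsAffineAt E F G₁ u) (h₂ : IsAffineAt E F G₂ u)
    (hu : u ∈ closure {v | ∀ᶠ w in 𝓝 v, G₁ w = G₂ w}) : ∀ᶠ w in 𝓝 u, G₁ w = G₂ w := by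
  have hfr : ∃ᶠ v in 𝓝 u, ∀ᶠ w in 𝓝 v, G₁ w = G₂ w := mem_closure_iff_frequently.1 hu
  have heq : G₁ u = G₂ u := by
    by_contra hne
    have hev := (h₁.1.prodMk h₂.1).eventually
      (isClosed_diagonal.isOpen_compl.mem_nhds (x := (G₁ u, G₂ u)) (by simpa using hne))
    obtain ⟨v, hv, hv'⟩ := (hfr.and_eventually hev).exists
    exact hv' (by simpa using hv.self_of_nhds)
  obtain ⟨c₁, A, hA⟩ := h₁
  obtain ⟨c₂, B, hB⟩ := h₂
  rw [← heq] at hB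
  simp only [chartAt_self_eq, OpenPartialHomeomorph.refl_apply, id] at hA hB
  obtain ⟨v, hv, hAv, hBv⟩ := (hfr.and_eventually
    (eventually_eventually_nhds.2 hA |>.and (eventually_eventually_nhds.2 hB))).exists
  -- The germs of both maps at `v` coincide, and `v` is close enough to `u` for `A` and `B` to
  -- represent them there; an affine map being determined by any of its germs, the agreement
  -- propagates back to `u`.
  have hAB : A = B := by
    refine ContinuousAffineMap.eq_of_eventuallyEq (x := v) ?_
    filter_upwards [hv, hAv, hBv] with w h1 h2 h3
    rw [← h2, ← h3, h1]
  have hs := (chartAt F (G₁ u)).open_source.mem_nhds (mem_chart_source F (G₁ u))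
  filter_upwards [hA, hB, c₁.eventually hs, c₂.eventually (by rw [← heq]; exact hs)]
    with w h1 h2 h3 h4
  exact (chartAt F (G₁ u)).injOn h3 h4 (by rw [h1, h2, hAB])

/-- The identity theorem for affine maps. -/
theorem eventuallyEq_of_isPreconnected [T2Space N] {G₁ G₂ : E → N} {U : Set E}
    (hU : IsPreconnected U) (h₁ : ∀ u ∈ U, IsAffineAt E F G₁ u) (h₂ : ∀ u ∈ U, IsAffineAt E F G₂ u)
    {u₀ : E} (hu₀ : u₀ ∈ U) (h : ∀ᶠ w in 𝓝 u₀, G₁ w = G₂ w) {u : E} (hu : u ∈ U) :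
    ∀ᶠ w in 𝓝 u, G₁ w = G₂ w :=
  hU.subset_of_closure_inter_subset (u := {v | ∀ᶠ w in 𝓝 v, G₁ w = G₂ w})
    isOpen_setOfPred_eventually_nhds ⟨u₀, hu₀, h⟩
    (fun v hv => (h₁ v hv.2).eventuallyEq_of_mem_closure (h₂ v hv.2) hv.1) hu

/-- Two lifts of a path through affine local homeomorphisms with the same germ at the starting
point coincide. -/
theorem eq_of_lifts [T2Space N] {I : Type*} [TopologicalSpace I] [PreconnectedSpace I]
    {c₁ c₂ : I → E} (hc₁ : Continuous c₁) (hc₂ : Continuous c₂) {G₁ G₂ : E → N}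
    (h₁ : ∀ t, IsAffineAt E F G₁ (c₁ t)) (h₂ : ∀ t, IsAffineAt E F G₂ (c₂ t))
    (hinj : ∀ t, ∃ V ∈ 𝓝 (c₁ t), InjOn G₁ V) (hG : ∀ t, G₁ (c₁ t) = G₂ (c₂ t))
    {t₀ : I} (ht₀ : c₁ t₀ = c₂ t₀) (h₀ : ∀ᶠ w in 𝓝 (c₁ t₀), G₁ w = G₂ w) (t : I) :
    c₁ t = c₂ t := by
  set T : Set I := {t | c₁ t = c₂ t ∧ ∀ᶠ w in 𝓝 (c₁ t), G₁ w = G₂ w}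
  have hclosed : IsClosed T := by
    refine isClosed_of_closure_subset fun t ht => ?_
    have heq : c₁ t = c₂ t :=
      (isClosed_eq hc₁ hc₂).closure_subset_iff.2 (fun s (hs : s ∈ T) => hs.1) ht
    refine ⟨heq, (h₁ t).eventuallyEq_of_mem_closure (heq ▸ h₂ t) ?_⟩
    exact closure_mono (by rintro _ ⟨s, hs, rfl⟩; exact hs.2)
      (image_closure_subset_closure_image hc₁ ⟨t, ht, rfl⟩)
  have hopen : IsOpen T := by
    refine isOpen_iff_mem_nhds.2 fun t ht => ?_
    obtain ⟨V, hV, hVinj⟩ := hinj t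
    have hV₂ : V ∈ 𝓝 (c₂ t) := ht.1 ▸ hV
    have hev₂ : ∀ᶠ w in 𝓝 (c₂ t), G₁ w = G₂ w := ht.1 ▸ ht.2
    filter_upwards [hc₁.continuousAt.eventually hV, hc₂.continuousAt.eventually hV₂,
      hc₁.continuousAt.eventually (eventually_eventually_nhds.2 ht.2),
      hc₂.continuousAt.eventually hev₂] with s h3 h4 h5 h6
    exact ⟨hVinj h3 h4 (by rw [hG s, h6]), h5⟩
  have := IsClopen.eq_univ ⟨hclosed, hopen⟩ ⟨t₀, ht₀, h₀⟩
  exact (this ▸ mem_univ t : t ∈ T).1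

theorem IsAffineMap.comp {G : Type*} [NormedAddCommGroup G] [NormedSpace ℝ G]
    {P : Type*} [TopologicalSpace P] [ChartedSpace G P] {k : N → P} {h : M → N}
    (hk : IsAffineMap F G k) (hh : IsAffineMap E F h) : IsAffineMap E G (k ∘ h) :=
  isAffineMap_of_forall_isAffineAt fun x => (hk.isAffineAt _).comp (hh.isAffineAt x)

theorem IsAffineMap.iterate {f : M → M} (hf : IsAffineMap E E f) (m : ℕ) :
    IsAffineMap E E f^[m] := by
  induction m with
  | zero => exact isAffineMap_of_forall_isAffineAt isAffineAt_id
  | succ m ih => exact ih.comp hf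

theorem IsAffineMap.diffeomorph_symm [IsManifold 𝓘(ℝ, E) 1 M]
    {f : Diffeomorph 𝓘(ℝ, E) 𝓘(ℝ, E) M M ∞} (hf : IsAffineMap E E f) :
    IsAffineMap E E f.symm := by
  refine isAffineMap_of_forall_isAffineAt fun z => ⟨f.symm.continuous.continuousAt, ?_⟩
  obtain ⟨x, rfl⟩ : ∃ x, f x = z := f.surjective z
  obtain ⟨hc, A, hA⟩ := hf.isAffineAt x
  set e := f.mfderivToContinuousLinearEquiv (x := x) (by simp)
  have hAe : ∀ v : E, A.contLinear v = e v := fun v => by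
    have h1 := (IsAffineAt.hasMFDerivAt hc hA).mfderiv
    rw [← h1]
    rfl
  let e' : E ≃L[ℝ] E := e
  -- The local expression of the inverse is `u ↦ φ x + e⁻¹ (u - φ' (f x))`, where `φ`, `φ'` are the
  -- charts at `x` and `f x` and `e` is the derivative of `f` at `x`.
  refine ⟨(e'.symm : E →L[ℝ] E).toContinuousAffineMap.comp
    (ContinuousAffineMap.id ℝ E - ContinuousAffineMap.const ℝ E (chartAt E (f x) (f x)))
      + ContinuousAffineMap.const ℝ E (chartAt E x x), ?_⟩
  have ht : Tendsto f.symm (𝓝 (f x)) (𝓝 x) := by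
    simpa using f.symm.continuous.tendsto (f x)
  filter_upwards [ht.eventually hA] with z hz
  simp only [Diffeomorph.apply_symm_apply] at hz
  have h2 := A.contLinear_map_vsub (chartAt E x (f.symm z)) (chartAt E x x)
  rw [vsub_eq_sub, hAe, vsub_eq_sub, ← hz, ← hA.self_of_nhds] at h2
  have h3 : e'.symm (chartAt E (f x) z - chartAt E (f x) (f x))
      = chartAt E x (f.symm z) - chartAt E x x := by
    rw [ContinuousLinearEquiv.symm_apply_eq]
    exact h2.symm
  rw [Diffeomorph.symm_apply_apply, ContinuousAffineMap.add_apply,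
    ContinuousAffineMap.comp_apply, ContinuousAffineMap.sub_apply]
  simp only [ContinuousAffineMap.coe_id, ContinuousAffineMap.coe_const, Function.const_apply, id]
  exact (sub_eq_iff_eq_add.1 h3.symm)

end LocallyAffine

/-! ### Charts of uniform size on a compact manifold, and short curves -/

section UniformCharts

variable {E : Type*} [NormedAddCommGroup E] [NormedSpace ℝ E]
  {M : Type*} [TopologicalSpace M] [ChartedSpace E M]

variable (E) in
/-- The derivative at `y` of the preferred chart at `p`. -/
noncomputable def chartDeriv (p y : M) : TangentSpace 𝓘(ℝ, E) y →L[ℝ] E :=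
  mfderiv 𝓘(ℝ, E) 𝓘(ℝ, E) (chartAt E p) y

theorem riemannianNorm_nonneg [IsManifold 𝓘(ℝ, E) 1 M]
    (g : Bundle.ContMDiffRiemannianMetric 𝓘(ℝ, E) ∞ E (fun x : M => TangentSpace 𝓘(ℝ, E) x))
    (x : M) (v : TangentSpace 𝓘(ℝ, E) x) : 0 ≤ riemannianNorm g x v :=
  Real.sqrt_nonneg _

open Bundle in
theorem riemannianNorm_add_le [IsManifold 𝓘(ℝ, E) 1 M]
    (g : Bundle.ContMDiffRiemannianMetric 𝓘(ℝ, E) ∞ E (fun x : M => TangentSpace 𝓘(ℝ, E) x))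
    (x : M) (v w : TangentSpace 𝓘(ℝ, E) x) :
    riemannianNorm g x (v + w) ≤ riemannianNorm g x v + riemannianNorm g x w := by
  let : RiemannianBundle (fun x : M => TangentSpace 𝓘(ℝ, E) x) := ⟨g.toRiemannianMetric⟩
  have hnorm : ∀ v : TangentSpace 𝓘(ℝ, E) x, riemannianNorm g x v = ‖v‖ := by
    intro v
    rw [riemannianNorm, ← Real.sqrt_sq (norm_nonneg v), ← real_inner_self_eq_norm_sq]
    rfl
  simp only [hnorm]
  exact norm_add_le v w

theorem riemannianNorm_neg [IsManifold 𝓘(ℝ, E) 1 M]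
    (g : Bundle.ContMDiffRiemannianMetric 𝓘(ℝ, E) ∞ E (fun x : M => TangentSpace 𝓘(ℝ, E) x))
    (x : M) (v : TangentSpace 𝓘(ℝ, E) x) : riemannianNorm g x (-v) = riemannianNorm g x v := by
  simp [riemannianNorm]

theorem eq_zero_of_riemannianNorm_le_zero [IsManifold 𝓘(ℝ, E) 1 M]
    (g : Bundle.ContMDiffRiemannianMetric 𝓘(ℝ, E) ∞ E (fun x : M => TangentSpace 𝓘(ℝ, E) x))
    {x : M} {v : TangentSpace 𝓘(ℝ, E) x} (hv : riemannianNorm g x v ≤ 0) : v = 0 := by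
  by_contra hne
  exact hv.not_gt (Real.sqrt_pos.2 (g.pos x v hne))

open Bundle in
-- The derivative of the chart at `p` is the trivialization of the tangent bundle at `p`; in a
-- continuous Riemannian bundle, trivializations and their inverses have locally bounded norm.
theorem exists_riemannianNorm_equiv [IsManifold 𝓘(ℝ, E) 1 M]
    (g : Bundle.ContMDiffRiemannianMetric 𝓘(ℝ, E) ∞ E (fun x : M => TangentSpace 𝓘(ℝ, E) x))
    (p : M) : ∃ C : ℝ, 0 < C ∧ ∀ᶠ y in 𝓝 p, ∀ v : TangentSpace 𝓘(ℝ, E) y,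
      ‖chartDeriv E p y v‖ ≤ C * riemannianNorm g y v ∧
      riemannianNorm g y v ≤ C * ‖chartDeriv E p y v‖ := by
  let : RiemannianBundle (fun x : M => TangentSpace 𝓘(ℝ, E) x) := ⟨g.toRiemannianMetric⟩
  have : IsContinuousRiemannianBundle E (fun x : M => TangentSpace 𝓘(ℝ, E) x) :=
    ⟨⟨g.inner, g.contMDiff.continuous, fun _ _ _ => rfl⟩⟩
  have hnorm : ∀ (y : M) (v : TangentSpace 𝓘(ℝ, E) y), riemannianNorm g y v = ‖v‖ := by
    intro y v
    rw [riemannianNorm, ← Real.sqrt_sq (norm_nonneg v), ← real_inner_self_eq_norm_sq]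
    rfl
  obtain ⟨C₁, hC₁, h₁⟩ := eventually_norm_trivializationAt_lt E
    (fun x : M => TangentSpace 𝓘(ℝ, E) x) p
  obtain ⟨C₂, hC₂, h₂⟩ := eventually_norm_symmL_trivializationAt_lt E
    (fun x : M => TangentSpace 𝓘(ℝ, E) x) p
  refine ⟨max C₁ C₂, lt_max_of_lt_left hC₁, ?_⟩
  filter_upwards [h₁, h₂, (chartAt E p).open_source.mem_nhds (mem_chart_source E p)]
    with y h₁ h₂ hy v
  have key : chartDeriv E p y v
      = (trivializationAt E (TangentSpace 𝓘(ℝ, E)) p).continuousLinearMapAt ℝ y v := by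
    rw [TangentBundle.continuousLinearMapAt_trivializationAt hy]
    simp [chartDeriv]
  have hb : y ∈ (trivializationAt E (fun x : M => TangentSpace 𝓘(ℝ, E) x) p).baseSet := by
    simpa using hy
  rw [hnorm, key]
  constructor
  · refine (ContinuousLinearMap.le_opNorm _ _).trans ?_
    gcongr
    exact h₁.le.trans (le_max_left _ _)
  · have h3 := ((trivializationAt E (fun x : M => TangentSpace 𝓘(ℝ, E) x) p).symmL ℝ y).le_opNorm
      ((trivializationAt E (TangentSpace 𝓘(ℝ, E)) p).continuousLinearMapAt ℝ y v)
    rw [Bundle.Trivialization.symmL_continuousLinearMapAt _ hb] at h3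
    refine h3.trans ?_
    gcongr
    exact h₂.le.trans (le_max_right _ _)

/-- Each point `x` lies in the domain of the preferred chart at `p x`, whose image contains the
ball of radius `r` around the image of `x`; on this ball, the Riemannian norm and the norm in the
chart are equivalent, up to the constant `C`. -/
structure IsUniformCharts [IsManifold 𝓘(ℝ, E) 1 M]
    (g : Bundle.ContMDiffRiemannianMetric 𝓘(ℝ, E) ∞ E (fun x : M => TangentSpace 𝓘(ℝ, E) x))
    (p : M → M) (r C : ℝ) : Prop where
  r_pos : 0 < r
  C_pos : 0 < C
  mem_source (x : M) : x ∈ (chartAt E (p x)).source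
  ball_subset (x : M) : Metric.ball (chartAt E (p x) x) r ⊆ (chartAt E (p x)).target
  norm_chartDeriv_le (x : M) {y : M} (hy : y ∈ (chartAt E (p x)).source)
    (hy' : chartAt E (p x) y ∈ Metric.ball (chartAt E (p x) x) r) (v : TangentSpace 𝓘(ℝ, E) y) :
    ‖chartDeriv E (p x) y v‖ ≤ C * riemannianNorm g y v
  riemannianNorm_le (x : M) {y : M} (hy : y ∈ (chartAt E (p x)).source)
    (hy' : chartAt E (p x) y ∈ Metric.ball (chartAt E (p x) x) r) (v : TangentSpace 𝓘(ℝ, E) y) :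
    riemannianNorm g y v ≤ C * ‖chartDeriv E (p x) y v‖

theorem exists_isUniformCharts [IsManifold 𝓘(ℝ, E) 1 M] [CompactSpace M]
    (g : Bundle.ContMDiffRiemannianMetric 𝓘(ℝ, E) ∞ E (fun x : M => TangentSpace 𝓘(ℝ, E) x)) :
    ∃ (p : M → M) (r C : ℝ), IsUniformCharts g p r C := by
  have hloc : ∀ q : M, ∃ r C : ℝ, 0 < r ∧ 0 < C ∧
      Metric.ball (chartAt E q q) (2 * r) ⊆ (chartAt E q).target ∧
      ∀ y ∈ (chartAt E q).source, chartAt E q y ∈ Metric.ball (chartAt E q q) (2 * r) →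
        ∀ v : TangentSpace 𝓘(ℝ, E) y, ‖chartDeriv E q y v‖ ≤ C * riemannianNorm g y v ∧
          riemannianNorm g y v ≤ C * ‖chartDeriv E q y v‖ := by
    intro q
    obtain ⟨C, hC, hev⟩ := exists_riemannianNorm_equiv g q
    have hs : Tendsto (chartAt E q).symm (𝓝 (chartAt E q q)) (𝓝 q) := by
      have := ((chartAt E q).continuousAt_symm (mem_chart_target E q)).tendsto
      rwa [(chartAt E q).left_inv (mem_chart_source E q)] at this
    obtain ⟨ε, hε, hball⟩ := Metric.eventually_nhds_iff_ball.1 ((hs.eventually hev).and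
      ((chartAt E q).open_target.mem_nhds (mem_chart_target E q)))
    refine ⟨ε / 2, C, by positivity, hC, ?_, ?_⟩
    · rw [mul_div_cancel₀ _ two_ne_zero]
      exact fun u hu => (hball u hu).2
    · intro y hy hy'
      rw [mul_div_cancel₀ _ two_ne_zero] at hy'
      have := (hball _ hy').1
      rwa [(chartAt E q).left_inv hy] at this
  choose ρ K hρ hK hball hnorm using hloc
  obtain ⟨t, -, ht⟩ := isCompact_univ.elim_nhds_subcover
    (fun q : M => (chartAt E q).source ∩ chartAt E q ⁻¹' Metric.ball (chartAt E q q) (ρ q))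
    (fun q _ => ((chartAt E q).isOpen_inter_preimage Metric.isOpen_ball).mem_nhds
        ⟨mem_chart_source E q, Metric.mem_ball_self (hρ q)⟩)
  have hcov : ∀ x : M, ∃ q ∈ t, x ∈ (chartAt E q).source ∧
      chartAt E q x ∈ Metric.ball (chartAt E q q) (ρ q) := by
    intro x
    obtain ⟨q, hq, h⟩ := mem_iUnion₂.1 (ht (mem_univ x))
    exact ⟨q, hq, h⟩
  choose p hpt hps hpb using hcov
  obtain ⟨r, hr, hrle⟩ : ∃ r : ℝ, 0 < r ∧ ∀ q ∈ t, r ≤ ρ q :=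
    (eventually_and.2 ⟨self_mem_nhdsWithin, (Filter.eventually_all_finset t).2 fun q _ =>
      mem_of_superset (Ioc_mem_nhdsGT (hρ q)) fun _ h => h.2⟩ :
      ∀ᶠ r in 𝓝[>] (0 : ℝ), 0 < r ∧ ∀ q ∈ t, r ≤ ρ q).exists
  obtain ⟨C, hC, hCle⟩ : ∃ C : ℝ, 0 < C ∧ ∀ q ∈ t, K q ≤ C := by
    -- The summand `1` keeps the constant positive when the subcover is empty.
    refine ⟨1 + ∑ q ∈ t, K q, ?_, fun q hq => ?_⟩
    · have := t.sum_nonneg fun q _ => (hK q).le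
      linarith
    · have := Finset.single_le_sum (fun q _ => (hK q).le) hq
      linarith
  have hsub : ∀ x, Metric.ball (chartAt E (p x) x) r ⊆
      Metric.ball (chartAt E (p x) (p x)) (2 * ρ (p x)) := by
    intro x
    refine Metric.ball_subset_ball' ?_
    have := Metric.mem_ball.1 (hpb x)
    linarith [hrle _ (hpt x)]
  refine ⟨p, r, C, hr, hC, hps, fun x => (hsub x).trans (hball _), ?_, ?_⟩
  · intro x y hy hy' v
    refine ((hnorm _ y hy (hsub x hy') v).1).trans ?_
    gcongr
    · exact riemannianNorm_nonneg g y v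
    · exact hCle _ (hpt x)
  · intro x y hy hy' v
    refine ((hnorm _ y hy (hsub x hy') v).2).trans ?_
    gcongr
    exact hCle _ (hpt x)

theorem hasDerivAt_chartAt_comp [IsManifold 𝓘(ℝ, E) 1 M] {c : ℝ → M} {t : ℝ} {q : M}
    (hc : MDifferentiableAt 𝓘(ℝ, ℝ) 𝓘(ℝ, E) c t) (hq : c t ∈ (chartAt E q).source) :
    HasDerivAt (fun s => chartAt E q (c s))
      (chartDeriv E q (c t) (mfderiv 𝓘(ℝ, ℝ) 𝓘(ℝ, E) c t (1 : ℝ))) t := by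
  have hφ : MDifferentiableAt 𝓘(ℝ, E) 𝓘(ℝ, E) (chartAt E q) (c t) :=
    mdifferentiableAt_atlas (chart_mem_atlas E q) hq
  let T : ℝ →L[ℝ] E := (chartDeriv E q (c t)).comp (mfderiv 𝓘(ℝ, ℝ) 𝓘(ℝ, E) c t)
  have h : HasFDerivAt (fun s => chartAt E q (c s)) T t :=
    hasMFDerivAt_iff_hasFDerivAt.1 (hφ.hasMFDerivAt.comp t hc.hasMFDerivAt)
  exact h.hasDerivAt

/-- Locally, the velocity read in a uniform chart is continuous and its Riemannian norm is at most
`C` times its norm in the chart; compactness of `[0, 1]` makes the bound global. -/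
theorem exists_riemannianNorm_velocity_le [IsManifold 𝓘(ℝ, E) 1 M]
    {g : Bundle.ContMDiffRiemannianMetric 𝓘(ℝ, E) ∞ E (fun x : M => TangentSpace 𝓘(ℝ, E) x)}
    {p : M → M} {r C : ℝ} (h : IsUniformCharts g p r C) {c : ℝ → M}
    (hc : ContMDiff 𝓘(ℝ, ℝ) 𝓘(ℝ, E) 1 c) :
    ∃ K : ℝ, 0 ≤ K ∧ ∀ t ∈ Icc (0 : ℝ) 1,
      riemannianNorm g (c t) (mfderiv 𝓘(ℝ, ℝ) 𝓘(ℝ, E) c t (1 : ℝ)) ≤ K := by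
  refine isCompact_Icc.induction_on (p := fun s => ∃ K : ℝ, 0 ≤ K ∧ ∀ t ∈ s,
      riemannianNorm g (c t) (mfderiv 𝓘(ℝ, ℝ) 𝓘(ℝ, E) c t (1 : ℝ)) ≤ K) ⟨0, le_rfl, by simp⟩
    ?_ ?_ ?_
  · rintro s s' hs ⟨K, hK, h'⟩
    exact ⟨K, hK, fun t ht => h' t (hs ht)⟩
  · rintro s s' ⟨K, hK, h₁⟩ ⟨K', hK', h₂⟩
    refine ⟨max K K', hK.trans (le_max_left _ _), ?_⟩
    rintro t (ht | ht)
    exacts [(h₁ t ht).trans (le_max_left _ _), (h₂ t ht).trans (le_max_right _ _)]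
  · intro t₀ _
    set φ := chartAt E (p (c t₀))
    have hs : ∀ᶠ t in 𝓝 t₀, c t ∈ φ.source :=
      hc.continuous.continuousAt.eventually (φ.open_source.mem_nhds (h.mem_source (c t₀)))
    have hφc : ContDiffAt ℝ 1 (fun t => φ (c t)) t₀ :=
      contMDiffAt_iff_contDiffAt.1 <|
        (contMDiffAt_of_mem_maximalAtlas (IsManifold.chart_mem_maximalAtlas (p (c t₀)))
          (h.mem_source (c t₀))).comp t₀ hc.contMDiffAt
    have hb : ∀ᶠ t in 𝓝 t₀, φ (c t) ∈ Metric.ball (φ (c t₀)) r :=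
      hφc.continuousAt.eventually (Metric.ball_mem_nhds _ h.r_pos)
    have hd : ContinuousAt (fun t => ‖fderiv ℝ (fun t => φ (c t)) t 1‖) t₀ :=
      ((hφc.fderiv_right (m := 0) (by simp)).continuousAt.clm_apply continuousAt_const).norm
    have hd' := hd.eventually_le_const (lt_add_one _)
    refine ⟨_, mem_nhdsWithin_of_mem_nhds (hs.and (hb.and hd')),
      C * (‖fderiv ℝ (fun t => φ (c t)) t₀ 1‖ + 1),
      mul_nonneg h.C_pos.le (by positivity), ?_⟩
    rintro t ⟨h₁, h₂, h₃⟩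
    refine (h.riemannianNorm_le (c t₀) h₁ h₂ _).trans ?_
    have := (hasDerivAt_chartAt_comp (hc.mdifferentiable one_ne_zero t) h₁).deriv
    rw [← this, ← fderiv_apply_one_eq_deriv]
    exact mul_le_mul_of_nonneg_left h₃ h.C_pos.le

/-- A curve of length at most `δ` stays in the uniform chart at its starting point. -/
theorem IsUniformCharts.norm_chartAt_sub_le [IsManifold 𝓘(ℝ, E) 1 M] [T2Space M] [ProperSpace E]
    {g : Bundle.ContMDiffRiemannianMetric 𝓘(ℝ, E) ∞ E (fun x : M => TangentSpace 𝓘(ℝ, E) x)}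
    {p : M → M} {r C : ℝ} (h : IsUniformCharts g p r C) {c : ℝ → M}
    (hc : MDifferentiable 𝓘(ℝ, ℝ) 𝓘(ℝ, E) c) {δ : ℝ} (hδ : C * δ < r)
    (hspeed : ∀ t ∈ Icc (0 : ℝ) 1,
      riemannianNorm g (c t) (mfderiv 𝓘(ℝ, ℝ) 𝓘(ℝ, E) c t (1 : ℝ)) ≤ δ)
    {t : ℝ} (ht : t ∈ Icc (0 : ℝ) 1) :
    c t ∈ (chartAt E (p (c 0))).source ∧
      ‖chartAt E (p (c 0)) (c t) - chartAt E (p (c 0)) (c 0)‖ ≤ C * δ := by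
  set φ := chartAt E (p (c 0))
  set ρ := C * δ
  have hδ0 : 0 ≤ δ := (riemannianNorm_nonneg _ _ _).trans (hspeed 0 (by simp))
  have hρ : 0 ≤ ρ := mul_nonneg h.C_pos.le hδ0
  have hsub : Metric.closedBall (φ (c 0)) ρ ⊆ φ.target :=
    (Metric.closedBall_subset_ball hδ).trans (h.ball_subset _)
  set K := φ.symm '' Metric.closedBall (φ (c 0)) ρ
  -- Compact in a Hausdorff space: this is what prevents the curve from leaving the chart domain at
  -- a limit time.
  have hK : IsClosed K :=
    ((isCompact_closedBall _ _).image_of_continuousOn (φ.continuousOn_symm.mono hsub)).isClosed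
  have hKs : K ⊆ φ.source := by
    rintro _ ⟨u, hu, rfl⟩
    exact φ.map_target (hsub hu)
  -- Continuous induction on `[0, 1]`. The bound is linear in `t`, so the mean value estimate on a
  -- further interval `[s, s']` adds to it without loss.
  set S : Set ℝ := c ⁻¹' K ∩ {t | ‖φ (c t) - φ (c 0)‖ ≤ ρ * t}
  have hmem : ∀ s ∈ Icc (0 : ℝ) 1, c s ∈ φ.source → ‖φ (c s) - φ (c 0)‖ ≤ ρ * s → s ∈ S := by
    intro s hs h₁ h₂
    refine ⟨⟨φ (c s), ?_, φ.left_inv h₁⟩, h₂⟩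
    rw [mem_closedBall_iff_norm]
    nlinarith [hs.1, hs.2]
  have hclosed : IsClosed (S ∩ Icc 0 1) := by
    refine IsClosed.inter ?_ isClosed_Icc
    have h₁ : IsClosed (c ⁻¹' K) := hK.preimage hc.continuous
    have h₂ : ContinuousOn (fun t => ρ * t - ‖φ (c t) - φ (c 0)‖) (c ⁻¹' K) := by
      refine ContinuousOn.sub (by fun_prop) (ContinuousOn.norm (ContinuousOn.sub ?_ (by fun_prop)))
      exact φ.continuousOn.comp hc.continuous.continuousOn fun t ht => hKs ht
    have h₃ := h₂.preimage_isClosed_of_isClosed h₁ (isClosed_Ici (a := (0 : ℝ)))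
    convert h₃ using 2
    ext t
    simp
  have hS : Icc (0 : ℝ) 1 ⊆ S := by
    refine hclosed.Icc_subset_of_forall_exists_gt
      (hmem 0 (by simp) (h.mem_source _) (by simp)) ?_
    rintro s ⟨hsS, hs⟩ b hb
    have hsφ : c s ∈ φ.source := hKs hsS.1
    have hev : ∀ᶠ s' in 𝓝 s, c s' ∈ φ.source ∧ φ (c s') ∈ Metric.ball (φ (c 0)) r := by
      refine (hc.continuous.continuousAt.eventually (φ.open_source.mem_nhds hsφ)).and ?_
      refine ((φ.continuousAt hsφ).comp hc.continuous.continuousAt).eventually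
        (Metric.isOpen_ball.mem_nhds ?_)
      rw [mem_ball_iff_norm]
      refine (hsS.2.trans ?_).trans_lt hδ
      nlinarith [hs.1, hs.2]
    obtain ⟨ε, hε, hball⟩ := Metric.eventually_nhds_iff_ball.1 hev
    obtain ⟨s', hs', hs'b⟩ : ∃ s', s < s' ∧ s' < min (min b 1) (s + ε) :=
      exists_between (lt_min (lt_min hb hs.2) (by linarith))
    have hs'1 : s' < b := hs'b.trans_le ((min_le_left _ _).trans (min_le_left _ _))
    have hs'2 : s' < 1 := hs'b.trans_le ((min_le_left _ _).trans (min_le_right _ _))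
    have hs'3 : s' < s + ε := hs'b.trans_le (min_le_right _ _)
    have hin : ∀ τ ∈ Icc s s', c τ ∈ φ.source ∧ φ (c τ) ∈ Metric.ball (φ (c 0)) r := by
      intro τ hτ
      refine hball τ ?_
      rw [Metric.mem_ball, Real.dist_eq, abs_of_nonneg (by linarith [hτ.1])]
      linarith [hτ.2]
    have hmv := norm_image_sub_le_of_norm_deriv_le_segment' (a := s) (b := s')
      (f := fun τ => φ (c τ)) (C := ρ)
      (fun τ hτ => (hasDerivAt_chartAt_comp (hc τ) (hin τ hτ).1).hasDerivWithinAt)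
      (fun τ hτ => by
        have h₁ := hin τ ⟨hτ.1, hτ.2.le⟩
        refine (h.norm_chartDeriv_le (c 0) h₁.1 h₁.2 _).trans ?_
        refine mul_le_mul_of_nonneg_left (hspeed τ ⟨?_, ?_⟩) h.C_pos.le
        · linarith [hs.1, hτ.1]
        · linarith [hτ.2])
      s' ⟨hs'.le, le_rfl⟩
    refine ⟨s', hmem s' ⟨by linarith [hs.1], hs'2.le⟩ (hin s' ⟨hs'.le, le_rfl⟩).1 ?_, hs', hs'1.le⟩
    calc ‖φ (c s') - φ (c 0)‖ ≤ ‖φ (c s') - φ (c s)‖ + ‖φ (c s) - φ (c 0)‖ :=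
          norm_sub_le_norm_sub_add_norm_sub _ _ _
      _ ≤ ρ * (s' - s) + ρ * s := add_le_add hmv hsS.2
      _ = ρ * s' := by ring
  refine ⟨hKs (hS ht).1, (hS ht).2.trans ?_⟩
  exact mul_le_of_le_one_right hρ ht.2

/-- The Riemannian size of a derivative, computed in a uniform chart. -/
theorem IsUniformCharts.riemannianNorm_mfderiv_equiv [IsManifold 𝓘(ℝ, E) 1 M]
    {g : Bundle.ContMDiffRiemannianMetric 𝓘(ℝ, E) ∞ E (fun x : M => TangentSpace 𝓘(ℝ, E) x)}
    {p : M → M} {r C : ℝ} (h : IsUniformCharts g p r C)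
    {V : Type*} [NormedAddCommGroup V] [NormedSpace ℝ V] {G : V → M} {k : M → M} {w : V} {z : M}
    {Λ : V →L[ℝ] E} (hG : MDifferentiableAt 𝓘(ℝ, V) 𝓘(ℝ, E) G w)
    (hk : MDifferentiableAt 𝓘(ℝ, E) 𝓘(ℝ, E) k (G w))
    (hs : k (G w) ∈ (chartAt E (p z)).source) (hw : ‖Λ w‖ < r)
    (heq : ∀ᶠ w' in 𝓝 w, chartAt E (p z) (k (G w')) = chartAt E (p z) z + Λ w') (a : V) :
    riemannianNorm g (k (G w)) (mfderiv 𝓘(ℝ, E) 𝓘(ℝ, E) k (G w)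
        (mfderiv 𝓘(ℝ, V) 𝓘(ℝ, E) G w a)) ≤ C * ‖Λ a‖ ∧
      ‖Λ a‖ ≤ C * riemannianNorm g (k (G w)) (mfderiv 𝓘(ℝ, E) 𝓘(ℝ, E) k (G w)
        (mfderiv 𝓘(ℝ, V) 𝓘(ℝ, E) G w a)) := by
  have hφ : MDifferentiableAt 𝓘(ℝ, E) 𝓘(ℝ, E) (chartAt E (p z)) (k (G w)) :=
    mdifferentiableAt_atlas (chart_mem_atlas E _) hs
  let T : V →L[ℝ] E := (chartDeriv E (p z) (k (G w))).comp
    ((mfderiv 𝓘(ℝ, E) 𝓘(ℝ, E) k (G w)).comp (mfderiv 𝓘(ℝ, V) 𝓘(ℝ, E) G w))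
  have h₁ : HasFDerivAt (fun w' => chartAt E (p z) (k (G w'))) T w :=
    hasMFDerivAt_iff_hasFDerivAt.1
    (hφ.hasMFDerivAt.comp w (hk.hasMFDerivAt.comp w hG.hasMFDerivAt))
  have h₂ : HasFDerivAt (fun w' => chartAt E (p z) (k (G w'))) Λ w :=
    (Λ.hasFDerivAt.const_add (chartAt E (p z) z)).congr_of_eventuallyEq heq
  -- The composition of chart, `k` and `G` is a constant plus `Λ`, so the chain rule identifies the
  -- product of the three derivatives with `Λ`.
  have key : chartDeriv E (p z) (k (G w)) (mfderiv 𝓘(ℝ, E) 𝓘(ℝ, E) k (G w)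
      (mfderiv 𝓘(ℝ, V) 𝓘(ℝ, E) G w a)) = Λ a :=
    congrArg (fun T : V →L[ℝ] E => T a) (h₁.unique h₂)
  have hball : chartAt E (p z) (k (G w)) ∈ Metric.ball (chartAt E (p z) z) r := by
    rw [heq.self_of_nhds, mem_ball_iff_norm, add_sub_cancel_left]
    exact hw
  rw [← key]
  exact ⟨h.riemannianNorm_le z hs hball _, h.norm_chartDeriv_le z hs hball _⟩

end UniformCharts

/-! ### Pulling uniform charts back by the iterates of `f` -/

section AffineCharts

variable {E : Type*} [NormedAddCommGroup E] [NormedSpace ℝ E]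
  {M : Type*} [TopologicalSpace M] [ChartedSpace E M]

/-- In charts, `h` and `k` are affine maps `A` and `B` with `B ∘ A = id` near a point, hence
everywhere. So the linear part of `A` is injective, and bijective by finite dimension. -/
theorem exists_continuousLinearEquiv_of_leftInverse [FiniteDimensional ℝ E] [AffineManifold E M]
    {h k : M → M} (hh : IsAffineMap E E h)
    (hk : IsAffineMap E E k) (hkh : Function.LeftInverse k h) {q q' x : M}
    (hx : x ∈ (chartAt E q).source) (hx' : h x ∈ (chartAt E q').source) :
    ∃ L : E ≃L[ℝ] E, ∀ᶠ y in 𝓝 x,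
      chartAt E q' (h y) = chartAt E q' (h x) + L (chartAt E q y - chartAt E q x) := by
  set φ := chartAt E q
  set φ' := chartAt E q'
  have hφx : φ.symm (φ x) = x := φ.left_inv hx
  have hφx' : φ'.symm (φ' (h x)) = h x := φ'.left_inv hx'
  have hG₁ : IsAffineAt E E (fun u => h (φ.symm u)) (φ x) :=
    (hh.isAffineAt x).comp_of_eq (isAffineAt_chartAt_symm (φ.map_source hx)) hφx
  have hG : IsAffineAt E E (fun u => φ' (h (φ.symm u))) (φ x) :=
    (isAffineAt_chartAt hx').comp_of_eq hG₁ (congrArg h hφx)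
  have hG' : IsAffineAt E E (fun u => φ (k (φ'.symm u))) (φ' (h x)) :=
    (isAffineAt_chartAt hx).comp_of_eq ((hk.isAffineAt (h x)).comp_of_eq
      (isAffineAt_chartAt_symm (φ'.map_source hx')) hφx') (by rw [hφx', hkh x])
  obtain ⟨A, hA⟩ := hG.exists_eventuallyEq
  obtain ⟨B, hB⟩ := hG'.exists_eventuallyEq
  have hGt : Tendsto (fun u => φ' (h (φ.symm u))) (𝓝 (φ x)) (𝓝 (φ' (h x))) := by
    have := hG.1.tendsto
    rwa [hφx] at this
  have hG₁t : Tendsto (fun u => h (φ.symm u)) (𝓝 (φ x)) (𝓝 (h x)) := by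
    have := hG₁.1.tendsto
    rwa [hφx] at this
  have hBA : B.comp A = ContinuousAffineMap.id ℝ E := by
    refine ContinuousAffineMap.eq_of_eventuallyEq (x := φ x) ?_
    filter_upwards [hA, hGt.eventually hB, hG₁t.eventually (φ'.open_source.mem_nhds hx'),
      φ.open_target.mem_nhds (φ.map_source hx)] with u h₁ h₂ h₃ h₄
    rw [ContinuousAffineMap.comp_apply, ← h₁, ← h₂, φ'.left_inv h₃, hkh, φ.right_inv h₄]
    rfl
  have hinj : Function.Injective A.contLinear := by
    have h₁ : B.contLinear.comp A.contLinear = ContinuousLinearMap.id ℝ E := by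
      rw [← ContinuousAffineMap.comp_contLinear, hBA]
      rfl
    exact Function.LeftInverse.injective fun a =>
      congrArg (fun T : E →L[ℝ] E => T a) h₁
  let L : E ≃L[ℝ] E :=
    (LinearEquiv.ofInjectiveEndo (A.contLinear : E →ₗ[ℝ] E) hinj).toContinuousLinearEquiv
  have hL : ∀ a, L a = A.contLinear a := fun a => rfl
  refine ⟨L, ?_⟩
  filter_upwards [(φ.continuousAt hx).eventually hA, φ.open_source.mem_nhds hx] with y h₁ h₂
  have h₃ := hA.self_of_nhds
  rw [φ.left_inv h₂] at h₁
  rw [hφx] at h₃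
  rw [h₁, h₃, hL, ← ContinuousAffineMap.map_add_eq, add_sub_cancel]

/-- The submodule of vectors whose images by a sequence of linear maps are eventually bounded. -/
def eventuallyBounded (L : ℕ → E ≃L[ℝ] E) : Submodule ℝ E where
  carrier := {a | ∃ R : ℝ, ∀ᶠ m in atTop, ‖L m a‖ ≤ R}
  zero_mem' := ⟨0, by simp⟩
  add_mem' := by
    rintro a b ⟨R, hR⟩ ⟨R', hR'⟩
    refine ⟨R + R', ?_⟩
    filter_upwards [hR, hR'] with m h₁ h₂
    rw [map_add]
    exact (norm_add_le _ _).trans (add_le_add h₁ h₂)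
  smul_mem' := by
    rintro c a ⟨R, hR⟩
    refine ⟨‖c‖ * R, ?_⟩
    filter_upwards [hR] with m h₁
    rw [map_smul, norm_smul]
    gcongr

theorem mem_eventuallyBounded {L : ℕ → E ≃L[ℝ] E} {a : E} :
    a ∈ eventuallyBounded L ↔ ∃ R : ℝ, ∀ᶠ m in atTop, ‖L m a‖ ≤ R :=
  Iff.rfl

variable (f : Diffeomorph 𝓘(ℝ, E) 𝓘(ℝ, E) M M ∞)

/-- The inverse image by `f^[m]` of the affine parametrization, with linear part `L m`, of a
neighborhood of `f^[m] x` given by the chart at `p (f^[m] x)`. -/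
noncomputable def pullbackExp (p : M → M) (L : ℕ → E ≃L[ℝ] E) (x : M) (m : ℕ) (v : E) : M :=
  f.symm^[m] ((chartAt E (p (f^[m] x))).symm (chartAt E (p (f^[m] x)) (f^[m] x) + L m v))

/-- The linear maps `L m` are the linear parts at `x` of the iterates of `f`, in the charts given
by `p`. -/
def IsLinearPart (p : M → M) (L : ℕ → E ≃L[ℝ] E) (x : M) : Prop :=
  ∀ m : ℕ, ∀ᶠ y in 𝓝 x, chartAt E (p (f^[m] x)) (f^[m] y)
    = chartAt E (p (f^[m] x)) (f^[m] x) + L m (chartAt E (p x) y - chartAt E (p x) x)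

variable {f} {p : M → M} {L : ℕ → E ≃L[ℝ] E} {x : M}

theorem iterate_pullbackExp (m : ℕ) (v : E) : f^[m] (pullbackExp f p L x m v)
    = (chartAt E (p (f^[m] x))).symm (chartAt E (p (f^[m] x)) (f^[m] x) + L m v) :=
  Function.LeftInverse.iterate f.apply_symm_apply m _

/-- An explicit preimage of `y`, depending continuously on `y`: it is the lift used for curves whose
iterate stays in one chart. -/
theorem pullbackExp_eq_of_iterate (m : ℕ) {y : M}
    (hy : f^[m] y ∈ (chartAt E (p (f^[m] x))).source) :
    pullbackExp f p L x m ((L m).symm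
      (chartAt E (p (f^[m] x)) (f^[m] y) - chartAt E (p (f^[m] x)) (f^[m] x))) = y := by
  rw [pullbackExp, ContinuousLinearEquiv.apply_symm_apply, add_sub_cancel,
    (chartAt E (p (f^[m] x))).left_inv hy]
  exact Function.LeftInverse.iterate f.symm_apply_apply m y

variable [AffineManifold E M] {r C : ℝ}
  {g : Bundle.ContMDiffRiemannianMetric 𝓘(ℝ, E) ∞ E (fun x : M => TangentSpace 𝓘(ℝ, E) x)}

theorem exists_isLinearPart [FiniteDimensional ℝ E] (hf : IsAffineMap E E f) (h : IsUniformCharts g p r C) (x : M) :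
    ∃ L : ℕ → E ≃L[ℝ] E, IsLinearPart f p L x := by
  choose L hL using fun m : ℕ => exists_continuousLinearEquiv_of_leftInverse (hf.iterate m)
    (hf.diffeomorph_symm.iterate m) (Function.LeftInverse.iterate f.symm_apply_apply m)
    (h.mem_source x) (h.mem_source (f^[m] x))
  exact ⟨L, hL⟩

theorem IsUniformCharts.add_mem_target (h : IsUniformCharts g p r C) (z : M) {u : E}
    (hu : ‖u‖ < r) : chartAt E (p z) z + u ∈ (chartAt E (p z)).target :=
  h.ball_subset z (by simpa [mem_ball_iff_norm] using hu)

theorem iterate_pullbackExp_mem (h : IsUniformCharts g p r C) {m : ℕ} {v : E} (hv : ‖L m v‖ < r) :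
    f^[m] (pullbackExp f p L x m v) ∈ (chartAt E (p (f^[m] x))).source := by
  rw [iterate_pullbackExp]
  exact (chartAt E (p (f^[m] x))).map_target (h.add_mem_target _ hv)

theorem chartAt_iterate_pullbackExp (h : IsUniformCharts g p r C) {m : ℕ} {v : E}
    (hv : ‖L m v‖ < r) : chartAt E (p (f^[m] x)) (f^[m] (pullbackExp f p L x m v))
      = chartAt E (p (f^[m] x)) (f^[m] x) + L m v := by
  rw [iterate_pullbackExp]
  exact (chartAt E (p (f^[m] x))).right_inv (h.add_mem_target _ hv)

theorem pullbackExp_injOn (h : IsUniformCharts g p r C) (m : ℕ) :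
    InjOn (pullbackExp f p L x m) {v | ‖L m v‖ < r} := by
  intro v hv w hw hvw
  have h₁ := chartAt_iterate_pullbackExp (f := f) (x := x) h hv
  rw [hvw, chartAt_iterate_pullbackExp h hw] at h₁
  exact ((L m).injective (add_left_cancel h₁)).symm

theorem pullbackExp_zero (h : IsUniformCharts g p r C) (m : ℕ) :
    pullbackExp f p L x m 0 = x := by
  have := pullbackExp_eq_of_iterate (L := L) (y := x) m (h.mem_source (f^[m] x))
  rwa [sub_self, map_zero] at this

theorem isAffineAt_pullbackExp (hf : IsAffineMap E E f) (h : IsUniformCharts g p r C) {m : ℕ}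
    {v : E} (hv : ‖L m v‖ < r) : IsAffineAt E E (pullbackExp f p L x m) v := by
  refine ((hf.diffeomorph_symm.iterate m).isAffineAt _).comp ?_
  let T : E →ᴬ[ℝ] E := ContinuousAffineMap.const ℝ E (chartAt E (p (f^[m] x)) (f^[m] x))
    + (L m : E →L[ℝ] E).toContinuousAffineMap
  exact (isAffineAt_chartAt_symm (h.add_mem_target _ hv)).comp_of_eq
    (ContinuousAffineMap.isAffineAt T v) rfl

/-- Since `L m` is the linear part of `f^[m]` at `x`, applying `f.symm^[m]` undoes it: near `0`
every `pullbackExp` is the parametrization of `M` by the chart at `p x`, independently of `m`. -/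
theorem pullbackExp_eventuallyEq_zero (h : IsUniformCharts g p r C) (hL : IsLinearPart f p L x)
    (m m' : ℕ) : ∀ᶠ w in 𝓝 (0 : E), pullbackExp f p L x m w = pullbackExp f p L x m' w := by
  have key : ∀ m : ℕ, ∀ᶠ w in 𝓝 (0 : E), pullbackExp f p L x m w
      = (chartAt E (p x)).symm (chartAt E (p x) x + w) := by
    intro m
    set φ := chartAt E (p x)
    have ht : Tendsto (fun w : E => φ x + w) (𝓝 0) (𝓝 (φ x)) := by
      have : ContinuousAt (fun w : E => φ x + w) 0 := by fun_prop
      simpa using this.tendsto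
    have ht' : Tendsto (fun w : E => φ.symm (φ x + w)) (𝓝 0) (𝓝 x) := by
      have := (φ.continuousAt_symm (φ.map_source (h.mem_source x))).tendsto
      rw [φ.left_inv (h.mem_source x)] at this
      exact this.comp ht
    have hs : ∀ᶠ y in 𝓝 x, f^[m] y ∈ (chartAt E (p (f^[m] x))).source :=
      (f.continuous.iterate m).continuousAt.eventually
        ((chartAt E (p (f^[m] x))).open_source.mem_nhds (h.mem_source _))
    filter_upwards [ht'.eventually (hL m), ht'.eventually hs,
      ht.eventually (φ.open_target.mem_nhds (φ.map_source (h.mem_source x)))] with w h₁ h₂ h₃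
    rw [φ.right_inv h₃, add_sub_cancel_left] at h₁
    have h₄ := pullbackExp_eq_of_iterate (L := L) m h₂
    rwa [h₁, add_sub_cancel_left, ContinuousLinearEquiv.symm_apply_apply] at h₄
  filter_upwards [key m, key m'] with w h₁ h₂
  rw [h₁, h₂]

/-- The two ellipsoids meet in a convex set containing `0`, where the germs agree; the identity
theorem does the rest. -/
theorem pullbackExp_eventuallyEq [T2Space M] (hf : IsAffineMap E E f)
    (h : IsUniformCharts g p r C) (hL : IsLinearPart f p L x) {m m' : ℕ} {v : E}
    (hv : ‖L m v‖ < r) (hv' : ‖L m' v‖ < r) :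
    ∀ᶠ w in 𝓝 v, pullbackExp f p L x m w = pullbackExp f p L x m' w := by
  have hconv : Convex ℝ ((L m : E →ₗ[ℝ] E) ⁻¹' Metric.ball 0 r
      ∩ (L m' : E →ₗ[ℝ] E) ⁻¹' Metric.ball 0 r) :=
    ((convex_ball _ _).linear_preimage _).inter ((convex_ball _ _).linear_preimage _)
  refine eventuallyEq_of_isPreconnected (F := E) hconv.isPreconnected
    (fun u hu => isAffineAt_pullbackExp hf h ?_) (fun u hu => isAffineAt_pullbackExp hf h ?_)
    (u₀ := 0) ?_ (pullbackExp_eventuallyEq_zero h hL m m') ?_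
  · simpa using hu.1
  · simpa using hu.2
  · simpa using h.r_pos
  · simpa using And.intro hv hv'

/-- The sizes of the derivatives of a map `G` followed by an iterate of `f`, when `G` is linear
through `pullbackExp`. -/
theorem riemannianNorm_mfderiv_iterate (hf : IsAffineMap E E f) (h : IsUniformCharts g p r C)
    {V : Type*} [NormedAddCommGroup V] [NormedSpace ℝ V] {G : V → M} {B : V →L[ℝ] E} {w : V}
    {m : ℕ} (hG : MDifferentiableAt 𝓘(ℝ, V) 𝓘(ℝ, E) G w) (hw : ‖L m (B w)‖ < r)
    (heq : ∀ᶠ w' in 𝓝 w, G w' = pullbackExp f p L x m (B w')) (a : V) :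
    riemannianNorm g (f^[m] (G w)) (mfderiv 𝓘(ℝ, E) 𝓘(ℝ, E) f^[m] (G w)
        (mfderiv 𝓘(ℝ, V) 𝓘(ℝ, E) G w a)) ≤ C * ‖L m (B a)‖ ∧
      ‖L m (B a)‖ ≤ C * riemannianNorm g (f^[m] (G w)) (mfderiv 𝓘(ℝ, E) 𝓘(ℝ, E) f^[m] (G w)
        (mfderiv 𝓘(ℝ, V) 𝓘(ℝ, E) G w a)) := by
  refine h.riemannianNorm_mfderiv_equiv (z := f^[m] x) (Λ := (L m : E →L[ℝ] E).comp B) hG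
    ((hf.iterate m).isAffineAt _).mdifferentiableAt ?_ hw ?_ a
  · rw [heq.self_of_nhds]
    exact iterate_pullbackExp_mem h hw
  · have hcont : ContinuousAt (fun w' => ‖L m (B w')‖) w := by fun_prop
    filter_upwards [heq, hcont.eventually_lt continuousAt_const hw] with w' h₁ h₂
    rw [h₁, chartAt_iterate_pullbackExp h h₂]
    rfl

end AffineCharts

/-! ### The stable directions and the parametrization of the stable leaf -/

section StableLeaf

variable {E : Type*} [NormedAddCommGroup E] [NormedSpace ℝ E]
  {M : Type*} [TopologicalSpace M] [ChartedSpace E M]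

/-- An Anosov splitting for the Riemannian metric `g`, with constants `c`, `c'` and rate `l`. -/
structure IsAnosovSplittingWith [IsManifold 𝓘(ℝ, E) 1 M] (f : M → M)
    (Es Eu : ∀ x : M, Submodule ℝ (TangentSpace 𝓘(ℝ, E) x))
    (g : Bundle.ContMDiffRiemannianMetric 𝓘(ℝ, E) ∞ E (fun x : M => TangentSpace 𝓘(ℝ, E) x))
    (c c' l : ℝ) : Prop where
  isCompl (x : M) : IsCompl (Es x) (Eu x)
  c_pos : 0 < c
  c'_pos : 0 < c'
  l_pos : 0 < l
  l_lt_one : l < 1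
  stable {m : ℕ} (hm : 0 < m) (x : M) {v : TangentSpace 𝓘(ℝ, E) x} (hv : v ∈ Es x) :
    riemannianNorm g (f^[m] x) (mfderiv 𝓘(ℝ, E) 𝓘(ℝ, E) f^[m] x v)
      ≤ c * l ^ m * riemannianNorm g x v
  unstable {m : ℕ} (hm : 0 < m) (x : M) {w : TangentSpace 𝓘(ℝ, E) x} (hw : w ∈ Eu x) :
    c' * (l⁻¹) ^ m * riemannianNorm g x w
      ≤ riemannianNorm g (f^[m] x) (mfderiv 𝓘(ℝ, E) 𝓘(ℝ, E) f^[m] x w)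

theorem IsAnosovSplitting.exists_with [IsManifold 𝓘(ℝ, E) 1 M] {f : M → M}
    {Es Eu : ∀ x : M, Submodule ℝ (TangentSpace 𝓘(ℝ, E) x)} (hA : IsAnosovSplitting f Es Eu) :
    ∃ g c c' l, IsAnosovSplittingWith f Es Eu g c c' l := by
  obtain ⟨h, g, c, c', l, hc, hc', hl, hl', hs, hu⟩ := hA
  exact ⟨g, c, c', l, h, hc, hc', hl, hl', fun hm x _ hv => hs _ hm x _ hv,
    fun hm x _ hw => hu _ hm x _ hw⟩

section Rates

variable [IsManifold 𝓘(ℝ, E) 1 M] {f : M → M}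
  {Es Eu : ∀ x : M, Submodule ℝ (TangentSpace 𝓘(ℝ, E) x)}
  {g : Bundle.ContMDiffRiemannianMetric 𝓘(ℝ, E) ∞ E (fun x : M => TangentSpace 𝓘(ℝ, E) x)}
  {c c' l : ℝ}

theorem IsAnosovSplittingWith.tendsto_rate (hA : IsAnosovSplittingWith f Es Eu g c c' l) (K : ℝ) :
    Tendsto (fun m : ℕ => c * l ^ m * K) atTop (𝓝 0) := by
  have := ((tendsto_pow_atTop_nhds_zero_of_lt_one hA.l_pos.le hA.l_lt_one).const_mul c).mul_const K
  simpa using this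

/-- A nonzero unstable component grows exponentially while the stable one stays bounded. This
description of `Es` through forward orbits takes the place of continuity and invariance of the
distribution. -/
theorem IsAnosovSplittingWith.mem_iff_bounded (hA : IsAnosovSplittingWith f Es Eu g c c' l) {y : M}
    {v : TangentSpace 𝓘(ℝ, E) y} : v ∈ Es y ↔ ∃ R : ℝ, ∀ᶠ m in atTop,
      riemannianNorm g (f^[m] y) (mfderiv 𝓘(ℝ, E) 𝓘(ℝ, E) f^[m] y v) ≤ R := by
  have hbd : ∀ v ∈ Es y, ∀ᶠ m in atTop,
      riemannianNorm g (f^[m] y) (mfderiv 𝓘(ℝ, E) 𝓘(ℝ, E) f^[m] y v) ≤ 1 := by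
    intro v hv
    filter_upwards [(hA.tendsto_rate (riemannianNorm g y v)).eventually_le_const one_pos,
      eventually_gt_atTop 0] with m h₁ h₂
    exact (hA.stable h₂ y hv).trans h₁
  refine ⟨fun hv => ⟨1, hbd v hv⟩, fun ⟨R, hR⟩ => ?_⟩
  obtain ⟨a, ha, b, hb, rfl⟩ := Submodule.mem_sup.1
    ((hA.isCompl y).sup_eq_top ▸ Submodule.mem_top : v ∈ Es y ⊔ Eu y)
  suffices b = 0 by simpa [this] using ha
  refine eq_zero_of_riemannianNorm_le_zero g ?_
  -- The image of `b` has norm at most `R + 1` (`R` from `a + b`, `1` from the stable part `a`) and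
  -- at least `c' * l⁻¹ ^ m` times the norm of `b`.
  have hlim : Tendsto (fun m : ℕ => (R + 1) / c' * l ^ m) atTop (𝓝 0) := by
    simpa using (tendsto_pow_atTop_nhds_zero_of_lt_one hA.l_pos.le hA.l_lt_one).const_mul
      ((R + 1) / c')
  refine ge_of_tendsto hlim ?_
  filter_upwards [hR, hbd a ha, eventually_gt_atTop 0] with m h₁ h₂ h₃
  set T := mfderiv 𝓘(ℝ, E) 𝓘(ℝ, E) f^[m] y
  have h₄ : T b = T (a + b) + -T a := by rw [map_add]; abel
  have h₅ : riemannianNorm g (f^[m] y) (T b) ≤ R + 1 := by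
    rw [h₄]
    refine (riemannianNorm_add_le g _ _ _).trans ?_
    rw [riemannianNorm_neg]
    exact add_le_add h₁ h₂
  have h₆ := (hA.unstable h₃ y hb).trans h₅
  have hlm : 0 < l ^ m := pow_pos hA.l_pos m
  have hc' := hA.c'_pos
  rw [inv_pow] at h₆
  calc riemannianNorm g y b
      = c' * (l ^ m)⁻¹ * riemannianNorm g y b * (l ^ m / c') := by field_simp
    _ ≤ (R + 1) * (l ^ m / c') := by gcongr
    _ = (R + 1) / c' * l ^ m := by ring

end Rates

variable [AffineManifold E M] {f : Diffeomorph 𝓘(ℝ, E) 𝓘(ℝ, E) M M ∞}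
  {Es Eu : ∀ x : M, Submodule ℝ (TangentSpace 𝓘(ℝ, E) x)}
  {g : Bundle.ContMDiffRiemannianMetric 𝓘(ℝ, E) ∞ E (fun x : M => TangentSpace 𝓘(ℝ, E) x)}
  {c c' l r C : ℝ} {p : M → M} {L : ℕ → E ≃L[ℝ] E} {x : M}

/-- A map which is linear through all `pullbackExp`s with large index is tangent to the stable
distribution in the directions that the `L m` do not expand. -/
theorem mfderiv_mem_iff (hA : IsAnosovSplittingWith f Es Eu g c c' l) (hf : IsAffineMap E E f)
    (h : IsUniformCharts g p r C) {V : Type*} [NormedAddCommGroup V] [NormedSpace ℝ V] {G : V → M}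
    {B : V →L[ℝ] E} {w : V} (hG : MDifferentiableAt 𝓘(ℝ, V) 𝓘(ℝ, E) G w)
    (hw : ∀ᶠ m in atTop, ‖L m (B w)‖ < r)
    (heq : ∀ᶠ m in atTop, ∀ᶠ w' in 𝓝 w, G w' = pullbackExp f p L x m (B w')) (a : V) :
    mfderiv 𝓘(ℝ, V) 𝓘(ℝ, E) G w a ∈ Es (G w) ↔ B a ∈ eventuallyBounded L := by
  rw [hA.mem_iff_bounded, mem_eventuallyBounded]
  constructor
  · rintro ⟨R, hR⟩
    refine ⟨C * R, ?_⟩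
    filter_upwards [hR, hw, heq] with m h₁ h₂ h₃
    exact (riemannianNorm_mfderiv_iterate hf h hG h₂ h₃ a).2.trans
      (mul_le_mul_of_nonneg_left h₁ h.C_pos.le)
  · rintro ⟨R, hR⟩
    refine ⟨C * R, ?_⟩
    filter_upwards [hR, hw, heq] with m h₁ h₂ h₃
    exact (riemannianNorm_mfderiv_iterate hf h hG h₂ h₃ a).1.trans
      (mul_le_mul_of_nonneg_left h₁ h.C_pos.le)

/-- The lower bound in `riemannianNorm_mfderiv_iterate` shows that a vector killed by the derivative
of `G` is killed by the injective map `L m ∘ B`. -/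
theorem injective_mfderiv_of_pullbackExp (hf : IsAffineMap E E f)
    (h : IsUniformCharts g p r C) {V : Type*} [NormedAddCommGroup V] [NormedSpace ℝ V] {G : V → M}
    {B : V →L[ℝ] E} (hB : Function.Injective B) {w : V} {m : ℕ}
    (hG : MDifferentiableAt 𝓘(ℝ, V) 𝓘(ℝ, E) G w) (hw : ‖L m (B w)‖ < r)
    (heq : ∀ᶠ w' in 𝓝 w, G w' = pullbackExp f p L x m (B w')) :
    Function.Injective (mfderiv 𝓘(ℝ, V) 𝓘(ℝ, E) G w) := by
  refine (injective_iff_map_eq_zero _).2 fun a ha => ?_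
  have h₁ := (riemannianNorm_mfderiv_iterate hf h hG hw heq a).2
  rw [ha, map_zero] at h₁
  have h₂ : ‖L m (B a)‖ ≤ 0 := by simpa [riemannianNorm] using h₁
  rw [norm_le_zero_iff, map_eq_zero_iff _ (L m).injective] at h₂
  exact hB (h₂.trans B.map_zero.symm)

theorem eventually_pullbackExp_eventuallyEq [T2Space M] (hf : IsAffineMap E E f)
    (h : IsUniformCharts g p r C) (hL : IsLinearPart f p L x) {m₀ : ℕ} {v : E}
    (hv₀ : ‖L m₀ v‖ < r) (hv : ∀ᶠ m in atTop, ‖L m v‖ < r) :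
    ∀ᶠ m in atTop, ∀ᶠ w in 𝓝 v, pullbackExp f p L x m₀ w = pullbackExp f p L x m w := by
  filter_upwards [hv] with m hm
  exact pullbackExp_eventuallyEq hf h hL hv₀ hm

/-- The derivative of `pullbackExp` is a linear automorphism of `E` carrying `eventuallyBounded L`
onto the stable space. In particular the stable dimension is constant along the points reached from
`eventuallyBounded L`. -/
theorem finrank_stable_pullbackExp [T2Space M] [FiniteDimensional ℝ E]
    (hA : IsAnosovSplittingWith f Es Eu g c c' l) (hf : IsAffineMap E E f)
    (h : IsUniformCharts g p r C) (hL : IsLinearPart f p L x) {m₀ : ℕ} {v : E}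
    (hv₀ : ‖L m₀ v‖ < r) (hv : ∀ᶠ m in atTop, ‖L m v‖ < r) :
    Module.finrank ℝ (Es (pullbackExp f p L x m₀ v))
      = Module.finrank ℝ (eventuallyBounded L) := by
  have hG := (isAffineAt_pullbackExp (x := x) hf h hv₀).mdifferentiableAt
  have heq := eventually_pullbackExp_eventuallyEq hf h hL hv₀ hv
  have hmem := mfderiv_mem_iff (B := ContinuousLinearMap.id ℝ E) hA hf h hG hv heq
  have hinj := injective_mfderiv_of_pullbackExp (B := ContinuousLinearMap.id ℝ E) hf h
    Function.injective_id hG hv₀ (Eventually.of_forall fun _ => rfl)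
  let T : E →L[ℝ] E := mfderiv 𝓘(ℝ, E) 𝓘(ℝ, E) (pullbackExp f p L x m₀) v
  have hT : Function.Injective (T : E →ₗ[ℝ] E) := hinj
  let e : E ≃ₗ[ℝ] E := LinearEquiv.ofInjectiveEndo (T : E →ₗ[ℝ] E) hT
  let S : Submodule ℝ E := Es (pullbackExp f p L x m₀ v)
  have hS : (eventuallyBounded L).map (e : E →ₗ[ℝ] E) = S := by
    ext y
    constructor
    · rintro ⟨a, ha, rfl⟩
      exact (hmem a).2 ha
    · intro hy
      obtain ⟨a, rfl⟩ := e.surjective y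
      exact ⟨a, (hmem a).1 hy, rfl⟩
  have := LinearEquiv.finrank_map_eq e (eventuallyBounded L)
  rw [hS] at this
  exact this

/-- Boundedness improves to decay: such a vector corresponds to a stable tangent vector at `x`,
which the iterates contract at rate `c * l ^ m`. -/
theorem tendsto_of_mem_eventuallyBounded [T2Space M]
    (hA : IsAnosovSplittingWith f Es Eu g c c' l) (hf : IsAffineMap E E f)
    (h : IsUniformCharts g p r C) (hL : IsLinearPart f p L x) {a : E}
    (ha : a ∈ eventuallyBounded L) : Tendsto (fun m => ‖L m a‖) atTop (𝓝 0) := by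
  have hv : ∀ m, ‖L m (0 : E)‖ < r := fun m => by simpa using h.r_pos
  have hG := (isAffineAt_pullbackExp (x := x) hf h (hv 0)).mdifferentiableAt
  have heq := eventually_pullbackExp_eventuallyEq hf h hL (hv 0) (Eventually.of_forall hv)
  have hmem := (mfderiv_mem_iff (B := ContinuousLinearMap.id ℝ E) hA hf h hG
    (Eventually.of_forall hv) heq a).2 ha
  set ζ := mfderiv 𝓘(ℝ, E) 𝓘(ℝ, E) (pullbackExp f p L x 0) 0 a
  have hlim := (hA.tendsto_rate (riemannianNorm g _ ζ)).const_mul C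
  rw [mul_zero] at hlim
  refine squeeze_zero' (Eventually.of_forall fun m => norm_nonneg _) ?_ hlim
  filter_upwards [heq, eventually_gt_atTop 0] with m h₁ h₂
  exact (riemannianNorm_mfderiv_iterate (B := ContinuousLinearMap.id ℝ E) hf h hG (hv m) h₁ a).2.trans
    (mul_le_mul_of_nonneg_left (hA.stable h₂ _ hmem) h.C_pos.le)

/-- A curve tangent to the stable distribution ends, in the charts `pullbackExp`, at a vector which
the `L m` do not expand. -/
theorem exists_pullbackExp_eq_of_joinedTangentially [T2Space M] [FiniteDimensional ℝ E]
    (hA : IsAnosovSplittingWith f Es Eu g c c' l) (hf : IsAffineMap E E f)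
    (h : IsUniformCharts g p r C) (hL : IsLinearPart f p L x) {y : M}
    (hy : JoinedTangentially Es x y) :
    ∃ v ∈ eventuallyBounded L, ∃ m, ‖L m v‖ < r ∧ pullbackExp f p L x m v = y := by
  obtain ⟨γ, hγ, htan, hγ0, hγ1⟩ := hy
  obtain ⟨K, hK, hspeed⟩ := exists_riemannianNorm_velocity_le h hγ
  have hlim := (hA.tendsto_rate K).const_mul C
  rw [mul_zero] at hlim
  obtain ⟨m₀, hm₀⟩ := eventually_atTop.1
    ((hlim.eventually_lt_const h.r_pos).and (eventually_gt_atTop 0))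
  have hγd : MDifferentiable 𝓘(ℝ, ℝ) 𝓘(ℝ, E) γ := hγ.mdifferentiable one_ne_zero
  -- The curve `f^[m] ∘ γ` has speed at most `c * l ^ m * K`, and `m₀` was chosen so that `C` times
  -- this is less than `r`.
  have hstay : ∀ m ≥ m₀, ∀ t ∈ Icc (0 : ℝ) 1,
      f^[m] (γ t) ∈ (chartAt E (p (f^[m] x))).source ∧
      ‖chartAt E (p (f^[m] x)) (f^[m] (γ t)) - chartAt E (p (f^[m] x)) (f^[m] x)‖ < r := by
    intro m hm t ht
    have hFd : MDifferentiable 𝓘(ℝ, E) 𝓘(ℝ, E) f^[m] := fun z =>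
      ((hf.iterate m).isAffineAt z).mdifferentiableAt
    have := h.norm_chartAt_sub_le (c := fun t => f^[m] (γ t)) (hFd.comp hγd) (hm₀ m hm).1
      (fun s hs => by
        have h₁ : mfderiv 𝓘(ℝ, ℝ) 𝓘(ℝ, E) (fun t => f^[m] (γ t)) s (1 : ℝ)
            = mfderiv 𝓘(ℝ, E) 𝓘(ℝ, E) f^[m] (γ s) (mfderiv 𝓘(ℝ, ℝ) 𝓘(ℝ, E) γ s (1 : ℝ)) := by
          have := mfderiv_comp s (hFd (γ s)) (hγd s)
          exact congrArg (fun T : ℝ →L[ℝ] E => T 1) this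
        rw [h₁]
        refine (hA.stable (hm₀ m hm).2 _ (htan s)).trans ?_
        refine mul_le_mul_of_nonneg_left (hspeed s hs) ?_
        exact mul_nonneg hA.c_pos.le (pow_nonneg hA.l_pos.le _)) ht
    simp only [hγ0] at this
    exact ⟨this.1, this.2.trans_lt (hm₀ m hm).1⟩
  set v : ℕ → Icc (0 : ℝ) 1 → E := fun m t => (L m).symm
    (chartAt E (p (f^[m] x)) (f^[m] (γ t)) - chartAt E (p (f^[m] x)) (f^[m] x)) with hvdef
  have hvr : ∀ m ≥ m₀, ∀ t, ‖L m (v m t)‖ < r := fun m hm t => by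
    simpa [hvdef] using (hstay m hm t t.2).2
  have hvγ : ∀ m ≥ m₀, ∀ t, pullbackExp f p L x m (v m t) = γ t := fun m hm t =>
    pullbackExp_eq_of_iterate m (hstay m hm t t.2).1
  have hvc : ∀ m ≥ m₀, Continuous (v m) := fun m hm => by
    refine (L m).symm.continuous.comp (Continuous.sub ?_ continuous_const)
    refine (chartAt E (p (f^[m] x))).continuousOn.comp_continuous ?_
      fun t => (hstay m hm t t.2).1
    exact (f.continuous.iterate m).comp (hγ.continuous.comp continuous_subtype_val)
  have hv0 : ∀ m, v m 0 = 0 := fun m => by simp [hvdef, hγ0]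
  -- Both `v m₀` and `v m` lift `γ` from `0` through affine, locally injective maps with the same
  -- germ at `0`, so they coincide.
  have hconst : ∀ m ≥ m₀, v m₀ 1 = v m 1 := by
    intro m hm
    refine eq_of_lifts (F := E) (G₁ := pullbackExp f p L x m₀) (G₂ := pullbackExp f p L x m)
      (hvc m₀ le_rfl) (hvc m hm)
      (fun t => isAffineAt_pullbackExp hf h (hvr m₀ le_rfl t))
      (fun t => isAffineAt_pullbackExp hf h (hvr m hm t))
      (fun t => ⟨{v | ‖L m₀ v‖ < r}, ?_, pullbackExp_injOn h m₀⟩)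
      (fun t => by rw [hvγ m₀ le_rfl, hvγ m hm]) (t₀ := 0) (by rw [hv0, hv0]) ?_ 1
    · exact (isOpen_lt (L m₀).continuous.norm continuous_const).mem_nhds (hvr m₀ le_rfl t)
    · rw [hv0]
      exact pullbackExp_eventuallyEq_zero h hL m₀ m
  refine ⟨v m₀ 1, ⟨r, ?_⟩, m₀, hvr m₀ le_rfl 1, by rw [hvγ m₀ le_rfl, ← hγ1]; rfl⟩
  -- The fixed endpoint lies in the ellipsoid of every index `m ≥ m₀`, which is the required
  -- boundedness.
  filter_upwards [eventually_ge_atTop m₀] with m hm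
  rw [hconst m hm]
  exact (hvr m hm 1).le

/-- The leaf of the stable foliation through `x` is parametrized by an injective affine immersion
of a vector space. -/
theorem exists_stable_parametrization [T2Space M] [CompactSpace M] [FiniteDimensional ℝ E]
    (hA : IsAnosovSplitting f Es Eu) (hf : IsAffineMap E E f) (x : M) :
    ∃ Ψ : EuclideanSpace ℝ (Fin (leafDim Es x)) → M, Function.Injective Ψ ∧
      IsAffineMap (EuclideanSpace ℝ (Fin (leafDim Es x))) E Ψ ∧
      (∀ w, Function.Injective
        (mfderiv 𝓘(ℝ, EuclideanSpace ℝ (Fin (leafDim Es x))) 𝓘(ℝ, E) Ψ w)) ∧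
      (∀ w, (mfderiv 𝓘(ℝ, EuclideanSpace ℝ (Fin (leafDim Es x))) 𝓘(ℝ, E) Ψ w).range
        = Es (Ψ w)) ∧
      Ψ 0 = x ∧ ∀ y, JoinedTangentially Es x y → y ∈ range Ψ := by
  obtain ⟨g, c, c', l, hA⟩ := hA.exists_with
  obtain ⟨p, r, C, h⟩ := exists_isUniformCharts g
  obtain ⟨L, hL⟩ := exists_isLinearPart hf h x
  set K := eventuallyBounded L
  have hfin : Module.finrank ℝ (EuclideanSpace ℝ (Fin (leafDim Es x))) = Module.finrank ℝ K := by
    have h₀ : ∀ m, ‖L m (0 : E)‖ < r := fun m => by simpa using h.r_pos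
    have := finrank_stable_pullbackExp hA hf h hL (h₀ 0) (Eventually.of_forall h₀)
    rw [pullbackExp_zero h] at this
    rw [finrank_euclideanSpace_fin]
    exact this
  set V := EuclideanSpace ℝ (Fin (leafDim Es x))
  let ι : V ≃L[ℝ] K := ContinuousLinearEquiv.ofFinrankEq hfin
  let B : V →L[ℝ] E := K.subtypeL.comp (ι : V →L[ℝ] K)
  have hBinj : Function.Injective B := Subtype.val_injective.comp ι.injective
  have hBK : ∀ w, B w ∈ K := fun w => (ι w).2
  have hBsurj : ∀ v ∈ K, ∃ w, B w = v := fun v hv => ⟨ι.symm ⟨v, hv⟩, by simp [B]⟩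
  have hev : ∀ w, ∀ᶠ m in atTop, ‖L m (B w)‖ < r := fun w =>
    (tendsto_of_mem_eventuallyBounded hA hf h hL (hBK w)).eventually_lt_const h.r_pos
  -- Any index whose ellipsoid contains `B w` serves; `hΨ` shows that the value does not depend on
  -- it.
  choose N hN using fun w => (hev w).exists
  let Ψ : V → M := fun w => pullbackExp f p L x (N w) (B w)
  have hΨ : ∀ {m : ℕ} {w : V}, ‖L m (B w)‖ < r → Ψ w = pullbackExp f p L x m (B w) :=
    fun hm => (pullbackExp_eventuallyEq hf h hL (hN _) hm).self_of_nhds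
  have hΨev : ∀ {m : ℕ} {w : V}, ‖L m (B w)‖ < r →
      ∀ᶠ w' in 𝓝 w, Ψ w' = pullbackExp f p L x m (B w') := by
    intro m w hm
    have hcont : ContinuousAt (fun w' => ‖L m (B w')‖) w := by fun_prop
    filter_upwards [hcont.eventually_lt continuousAt_const hm] with w' hw'
    exact hΨ hw'
  have haff : IsAffineMap V E Ψ := isAffineMap_of_forall_isAffineAt fun w =>
    IsAffineAt.congr ((isAffineAt_pullbackExp hf h (hN w)).comp_of_eq
      (ContinuousAffineMap.isAffineAt B.toContinuousAffineMap w) rfl) (hΨev (hN w))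
  have hinj : ∀ w, Function.Injective (mfderiv 𝓘(ℝ, V) 𝓘(ℝ, E) Ψ w) := fun w =>
    injective_mfderiv_of_pullbackExp hf h hBinj (haff.isAffineAt w).mdifferentiableAt (hN w)
      (hΨev (hN w))
  refine ⟨Ψ, ?_, haff, hinj, ?_, ?_, ?_⟩
  · intro w w' hww'
    -- A single ellipsoid contains both vectors, and `pullbackExp` is injective there.
    obtain ⟨m, hm, hm'⟩ := ((hev w).and (hev w')).exists
    rw [hΨ hm, hΨ hm'] at hww'
    exact hBinj (pullbackExp_injOn h m hm hm' hww')
  · intro w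
    let T : V →L[ℝ] E := mfderiv 𝓘(ℝ, V) 𝓘(ℝ, E) Ψ w
    have hT : Function.Injective (T : V →ₗ[ℝ] E) := hinj w
    let S : Submodule ℝ E := Es (Ψ w)
    have hle : (T : V →ₗ[ℝ] E).range ≤ S := by
      rintro _ ⟨a, rfl⟩
      refine (mfderiv_mem_iff (x := x) hA hf h (haff.isAffineAt w).mdifferentiableAt (hev w) ?_
        a).2 (hBK a)
      filter_upwards [hev w] with m hm
      exact hΨev hm
    have hS : Module.finrank ℝ S = Module.finrank ℝ K :=
      finrank_stable_pullbackExp hA hf h hL (hN w) (hev w)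
    have hTS : (T : V →ₗ[ℝ] E).range = S := by
      refine Submodule.eq_of_le_of_finrank_eq hle ?_
      rw [LinearMap.finrank_range_of_inj hT, hS, hfin]
    exact hTS
  · have h₀ : ‖L 0 (B 0)‖ < r := by simpa using h.r_pos
    rw [hΨ h₀, map_zero, pullbackExp_zero h]
  · intro y hy
    obtain ⟨v, hv, m, hm, rfl⟩ := exists_pullbackExp_eq_of_joinedTangentially hA hf h hL hy
    obtain ⟨w, rfl⟩ := hBsurj v hv
    exact ⟨w, hΨ hm⟩

end StableLeaf

/-! ### From the parametrization to induced structures and their geodesics -/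

section InducedStructure

variable {E : Type*} [NormedAddCommGroup E] [NormedSpace ℝ E]
  {M : Type*} [TopologicalSpace M] [ChartedSpace E M]

theorem velocity_eq_of_eventually {c : ℝ → M} {t : ℝ} {y : M} (hy : c t = y)
    (hc : ContinuousAt c t) {v : TangentSpace 𝓘(ℝ, E) y}
    (hv : ∀ᶠ s in 𝓝 t, chartAt E y (c s) = chartAt E y y + (s - t) • (show E from v)) :
    velocity E c t = ⟨y, v⟩ := by
  subst hy
  let v' : E := v
  let A : ℝ →ᴬ[ℝ] E := ContinuousAffineMap.const ℝ ℝ (chartAt E (c t) (c t) - t • v')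
    + (ContinuousLinearMap.toSpanSingleton ℝ v').toContinuousAffineMap
  have hA : A.contLinear = ContinuousLinearMap.toSpanSingleton ℝ v' := by
    rw [ContinuousAffineMap.add_contLinear, ContinuousAffineMap.const_contLinear, zero_add,
      ContinuousLinearMap.toContinuousAffineMap_contLinear]
  have hev : ∀ᶠ s in 𝓝 t, chartAt E (c t) (c s) = A (chartAt ℝ t s) := by
    filter_upwards [hv] with s hs
    have hAs : A (chartAt ℝ t s) = chartAt E (c t) (c t) - t • v' + s • v' := rfl
    rw [hs, hAs, sub_smul]
    change chartAt E (c t) (c t) + (s • v' - t • v') = _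
    abel
  have h := (IsAffineAt.hasMFDerivAt hc hev).mfderiv
  have h₁ : mfderiv 𝓘(ℝ, ℝ) 𝓘(ℝ, E) c t (1 : ℝ) = v := by
    have h₂ : A.contLinear 1 = v' := by rw [hA]; simp
    exact (congrArg (fun T : ℝ →L[ℝ] E => T 1) h).trans h₂
  rw [velocity, h₁]

/-- If two maps are affine immersions tangent to the same distribution, the straight lines of the
source of the first one lift to geodesics of the second one. -/
theorem lift_line {V W : Type*} [NormedAddCommGroup V] [NormedSpace ℝ V]
    [NormedAddCommGroup W] [NormedSpace ℝ W] {N : Type*} [TopologicalSpace N] [ChartedSpace V N]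
    {D : ∀ x : M, Submodule ℝ (TangentSpace 𝓘(ℝ, E) x)}
    {i : N → M} (hinj : Function.Injective i) (hi : IsAffineMap V E i)
    (hirange : ∀ y, (mfderiv 𝓘(ℝ, V) 𝓘(ℝ, E) i y).range = D (i y))
    {Ψ : W → M} (hΨ : IsAffineMap W E Ψ)
    (hΨrange : ∀ w, (mfderiv 𝓘(ℝ, W) 𝓘(ℝ, E) Ψ w).range = D (Ψ w))
    {w η : W} {c : ℝ → N} (hc : ∀ t, i (c t) = Ψ (w + t • η)) {t : ℝ} {y : N} (hy : c t = y)
    {w₀ : W} (hw₀ : w + t • η = w₀) :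
    ContinuousAt c t ∧ ∃ v : V,
      (∀ᶠ s in 𝓝 t, chartAt V y (c s) = chartAt V y y + (s - t) • v) ∧
      (mfderiv 𝓘(ℝ, V) 𝓘(ℝ, E) i y : V →L[ℝ] E) v
        = (mfderiv 𝓘(ℝ, W) 𝓘(ℝ, E) Ψ w₀ : W →L[ℝ] E) η := by
  have hyw : i y = Ψ w₀ := by rw [← hy, ← hw₀, hc]
  obtain ⟨hci, A, hA⟩ := hi.isAffineAt y
  obtain ⟨hcΨ, A', hA'⟩ := hΨ.isAffineAt w₀
  have hdi : (mfderiv 𝓘(ℝ, V) 𝓘(ℝ, E) i y : V →L[ℝ] E) = A.contLinear :=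
    (IsAffineAt.hasMFDerivAt hci hA).mfderiv
  have hdΨ : (mfderiv 𝓘(ℝ, W) 𝓘(ℝ, E) Ψ w₀ : W →L[ℝ] E) = A'.contLinear :=
    (IsAffineAt.hasMFDerivAt hcΨ hA').mfderiv
  let D' : M → Submodule ℝ E := D
  have hmem : A'.contLinear η ∈ D' (Ψ w₀) := by
    have : mfderiv 𝓘(ℝ, W) 𝓘(ℝ, E) Ψ w₀ η ∈ D (Ψ w₀) := hΨrange w₀ ▸ ⟨η, rfl⟩
    rw [← hdΨ]
    exact this
  rw [← hyw] at hmem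
  -- Both derivatives have range `D` at the common image point, so the direction `η` has a
  -- counterpart `v` in the model of `N`.
  obtain ⟨v, hv⟩ : ∃ v : V, A.contLinear v = A'.contLinear η := by
    have h₁ : A'.contLinear η ∈ (mfderiv 𝓘(ℝ, V) 𝓘(ℝ, E) i y).range := by
      rw [hirange y]
      exact hmem
    rw [← hdi]
    exact h₁
  set ψ := chartAt V y
  set φ := chartAt E (i y) with hφ
  have hψy := mem_chart_source V y
  have hline : Tendsto (fun s : ℝ => ψ y + (s - t) • v) (𝓝 t) (𝓝 (ψ y)) := by
    have : ContinuousAt (fun s : ℝ => ψ y + (s - t) • v) t := by fun_prop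
    simpa [ContinuousAt] using this
  have hcurve : Tendsto (fun s : ℝ => ψ.symm (ψ y + (s - t) • v)) (𝓝 t) (𝓝 y) := by
    have := (ψ.continuousAt_symm (ψ.map_source hψy)).tendsto
    rw [ψ.left_inv hψy] at this
    exact this.comp hline
  have hline' : Tendsto (fun s : ℝ => w + s • η) (𝓝 t) (𝓝 w₀) := by
    have : ContinuousAt (fun s : ℝ => w + s • η) t := by fun_prop
    simpa [ContinuousAt, hw₀] using this
  have hsource := φ.open_source.mem_nhds (mem_chart_source E (i y))
  -- The curve `c` is only a set-theoretic lift. Near `t`, the straight segment in the chart of `N`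
  -- has the same image in `M`, and injectivity of `i` forces `c` to be that segment; continuity of
  -- `c` follows.
  have hceq : ∀ᶠ s in 𝓝 t, c s = ψ.symm (ψ y + (s - t) • v) ∧
      ψ y + (s - t) • v ∈ ψ.target := by
    filter_upwards [hcurve.eventually hA, hline'.eventually hA',
      (hci.tendsto.comp hcurve).eventually hsource,
      (hcΨ.tendsto.comp hline').eventually (hyw ▸ hsource),
      hline.eventually (ψ.open_target.mem_nhds (ψ.map_source hψy))] with s h₁ h₂ h₃ h₄ h₅
    refine ⟨hinj ?_, h₅⟩
    rw [hc]
    refine φ.injOn h₄ h₃ ?_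
    have h₆ : φ (Ψ (w + s • η)) = A' (w + s • η) := by rw [hφ, hyw]; exact h₂
    have h₇ : A (ψ y) = A' w₀ := by
      have := hA'.self_of_nhds
      rw [← hyw] at this
      exact hA.self_of_nhds.symm.trans this
    have h₈ : w + s • η = w₀ + (s - t) • η := by rw [← hw₀, sub_smul]; abel
    have h₁' : φ (i (ψ.symm (ψ y + (s - t) • v))) = A (ψ y + (s - t) • v) := by
      rw [ψ.right_inv h₅] at h₁
      exact h₁
    refine (h₆.trans ?_).trans h₁'.symm
    rw [h₈, ContinuousAffineMap.map_add_eq, ContinuousAffineMap.map_add_eq, h₇,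
      map_smul, map_smul, hv]
  refine ⟨?_, v, ?_, ?_⟩
  · have h₁ : Tendsto c (𝓝 t) (𝓝 y) := hcurve.congr' (hceq.mono fun s hs => hs.1.symm)
    rwa [← hy] at h₁
  · filter_upwards [hceq] with s hs
    rw [hs.1, ψ.right_inv hs.2]
  · rw [hdi, hdΨ]
    exact hv

/-- A tangent vector of `N` corresponds to a direction `η` at a point `w` of `W`. The line `w + t •
η` exists for all times and its image lies in that of `i`, so it lifts to a geodesic with the
prescribed velocity. -/
theorem geodesicallyComplete_of_parametrization {V W : Type*} [NormedAddCommGroup V]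
    [NormedSpace ℝ V] [NormedAddCommGroup W] [NormedSpace ℝ W] {N : Type*} [TopologicalSpace N]
    [ChartedSpace V N] {D : ∀ x : M, Submodule ℝ (TangentSpace 𝓘(ℝ, E) x)}
    {i : N → M} (hinj : Function.Injective i) (hi : IsAffineMap V E i)
    (hiinj : ∀ y, Function.Injective (mfderiv 𝓘(ℝ, V) 𝓘(ℝ, E) i y))
    (hirange : ∀ y, (mfderiv 𝓘(ℝ, V) 𝓘(ℝ, E) i y).range = D (i y))
    {Ψ : W → M} (hΨ : IsAffineMap W E Ψ)
    (hΨrange : ∀ w, (mfderiv 𝓘(ℝ, W) 𝓘(ℝ, E) Ψ w).range = D (Ψ w))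
    (hrange : range Ψ = range i) : GeodesicallyComplete V N := by
  rintro ⟨y, ξ⟩
  obtain ⟨w, hw⟩ : i y ∈ range Ψ := hrange ▸ mem_range_self y
  let D' : M → Submodule ℝ E := D
  have hmem : (mfderiv 𝓘(ℝ, V) 𝓘(ℝ, E) i y : V →L[ℝ] E) ξ ∈ D' (i y) := by
    have : mfderiv 𝓘(ℝ, V) 𝓘(ℝ, E) i y ξ ∈ D (i y) := hirange y ▸ ⟨ξ, rfl⟩
    exact this
  rw [← hw] at hmem
  obtain ⟨η, hη⟩ : ∃ η : W, (mfderiv 𝓘(ℝ, W) 𝓘(ℝ, E) Ψ w : W →L[ℝ] E) η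
      = (mfderiv 𝓘(ℝ, V) 𝓘(ℝ, E) i y : V →L[ℝ] E) ξ := by
    have h₁ : (mfderiv 𝓘(ℝ, V) 𝓘(ℝ, E) i y : V →L[ℝ] E) ξ
        ∈ (mfderiv 𝓘(ℝ, W) 𝓘(ℝ, E) Ψ w).range := by
      rw [hΨrange w]
      exact hmem
    exact h₁
  have hex : ∀ t : ℝ, ∃ z, i z = Ψ (w + t • η) := fun t => by
    have : Ψ (w + t • η) ∈ range i := hrange ▸ mem_range_self _
    exact this
  choose c hc using hex
  have hc0 : c 0 = y := hinj (by rw [hc, zero_smul, add_zero, hw])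
  have hlift := fun t => lift_line (t := t) hinj hi hirange hΨ hΨrange hc rfl rfl
  refine ⟨c, ⟨continuous_iff_continuousAt.2 fun t => (hlift t).1, fun t => ?_⟩, ?_⟩
  · obtain ⟨-, v, hv, -⟩ := hlift t
    refine ⟨chartAt V (c t) (c t) - t • v, v, ?_⟩
    filter_upwards [hv] with s hs
    rw [hs, sub_smul]
    abel
  · obtain ⟨hcont, v, hv, hvη⟩ := lift_line (t := 0) hinj hi hirange hΨ hΨrange hc hc0
      (w₀ := w) (by simp)
    -- The immersion hypothesis identifies the initial velocity of the lift.
    have hvξ : v = ξ := hiinj y (hvη.trans hη)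
    subst hvξ
    exact velocity_eq_of_eventually hc0 hcont hv

/-- The image of the line `t ↦ t • w` is a curve tangent to `D`. -/
theorem joinedTangentially_of_parametrization {W : Type*} [NormedAddCommGroup W] [NormedSpace ℝ W]
    {D : ∀ x : M, Submodule ℝ (TangentSpace 𝓘(ℝ, E) x)} {Ψ : W → M} (hΨ : IsAffineMap W E Ψ)
    (hΨrange : ∀ w, (mfderiv 𝓘(ℝ, W) 𝓘(ℝ, E) Ψ w).range = D (Ψ w)) (w : W) :
    JoinedTangentially D (Ψ 0) (Ψ w) := by
  have hline : ContDiff ℝ 1 (fun t : ℝ => t • w) := by fun_prop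
  refine ⟨fun t => Ψ (t • w), fun t => ?_, fun t => ?_, by simp, by simp⟩
  · exact ((hΨ.isAffineAt (t • w)).contMDiffAt 1).comp t hline.contMDiff.contMDiffAt
  · have h := mfderiv_comp t (hΨ.isAffineAt (t • w)).mdifferentiableAt
      ((hline.contMDiff.mdifferentiable one_ne_zero) t)
    have h₁ : mfderiv 𝓘(ℝ, ℝ) 𝓘(ℝ, E) (fun t : ℝ => Ψ (t • w)) t (1 : ℝ)
        = mfderiv 𝓘(ℝ, W) 𝓘(ℝ, E) Ψ (t • w)
          (mfderiv 𝓘(ℝ, ℝ) 𝓘(ℝ, W) (fun t : ℝ => t • w) t (1 : ℝ)) :=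
      congrArg (fun T : ℝ →L[ℝ] E => T 1) h
    change mfderiv 𝓘(ℝ, ℝ) 𝓘(ℝ, E) (fun t : ℝ => Ψ (t • w)) t (1 : ℝ) ∈ D (Ψ (t • w))
    rw [h₁, ← hΨrange]
    exact ⟨_, rfl⟩

/-- The bijection `e` given by `Ψ` transports the topology of the vector space to the leaf, and its
inverse is the only chart; in this chart the inclusion is `Ψ` itself. -/
theorem nonempty_inducedAffineStructure {D : ∀ x : M, Submodule ℝ (TangentSpace 𝓘(ℝ, E) x)}
    {x : M} {Ψ : EuclideanSpace ℝ (Fin (leafDim D x)) → M} (hinj : Function.Injective Ψ)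
    (hΨ : IsAffineMap (EuclideanSpace ℝ (Fin (leafDim D x))) E Ψ)
    (hΨinj : ∀ w, Function.Injective
      (mfderiv 𝓘(ℝ, EuclideanSpace ℝ (Fin (leafDim D x))) 𝓘(ℝ, E) Ψ w))
    (hΨrange : ∀ w, (mfderiv 𝓘(ℝ, EuclideanSpace ℝ (Fin (leafDim D x))) 𝓘(ℝ, E) Ψ w).range
      = D (Ψ w))
    (hleaf : ∀ y, JoinedTangentially D x y ↔ y ∈ range Ψ) :
    Nonempty (InducedAffineStructure D x) := by
  let V := EuclideanSpace ℝ (Fin (leafDim D x))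
  let e : V ≃ Leaf D x := Equiv.ofBijective (fun w => ⟨Ψ w, (hleaf _).2 ⟨w, rfl⟩⟩)
    ⟨fun w w' h => hinj (congrArg Subtype.val h), fun y => by
      obtain ⟨w, hw⟩ := (hleaf _).1 y.2
      exact ⟨w, Subtype.ext hw⟩⟩
  let top : TopologicalSpace (Leaf D x) := TopologicalSpace.induced e.symm inferInstance
  let φ : Leaf D x ≃ₜ V := e.symm.toHomeomorphOfIsInducing ⟨rfl⟩
  let charted : ChartedSpace V (Leaf D x) :=
    φ.toOpenPartialHomeomorph.singletonChartedSpace rfl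
  have affine : AffineManifold V (Leaf D x) :=
    { compatible := by
        rintro _ _ rfl rfl
        refine mem_groupoid_of_pregroupoid.2 ⟨fun u _ => ⟨ContinuousAffineMap.id ℝ V, ?_⟩,
          fun u _ => ⟨ContinuousAffineMap.id ℝ V, ?_⟩⟩ <;>
        exact Eventually.of_forall fun v => φ.apply_symm_apply v }
  have hincl : ∀ y, Leaf.incl D x y = Ψ (φ y) := fun y =>
    congrArg Subtype.val (e.apply_symm_apply y).symm
  have key : ∀ w : V, ∃ A : V →ᴬ[ℝ] E, (mfderiv 𝓘(ℝ, V) 𝓘(ℝ, E) Ψ w : V →L[ℝ] E) = A.contLinear ∧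
      ContinuousAt (Leaf.incl D x) (e w) ∧
      ∀ᶠ y in 𝓝 (e w), chartAt E (Leaf.incl D x (e w)) (Leaf.incl D x y)
        = A (chartAt V (e w) y) := by
    intro w
    obtain ⟨hc, A, hA⟩ := hΨ.isAffineAt w
    refine ⟨A, (IsAffineAt.hasMFDerivAt hc hA).mfderiv, ?_, ?_⟩
    · rw [show Leaf.incl D x = fun y => Ψ (φ y) from funext hincl]
      exact (hΨ.1.comp φ.continuous).continuousAt
    · have hφ : Tendsto φ (𝓝 (e w)) (𝓝 w) := by
        have := φ.continuous.tendsto (e w)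
        rwa [show φ (e w) = w from e.symm_apply_apply w] at this
      filter_upwards [hφ.eventually hA] with y hy
      rw [hincl y]
      exact hy
  have hmf : ∀ w : V, (mfderiv 𝓘(ℝ, V) 𝓘(ℝ, E) (Leaf.incl D x) (e w) : V →L[ℝ] E)
      = mfderiv 𝓘(ℝ, V) 𝓘(ℝ, E) Ψ w := by
    intro w
    obtain ⟨A, h₁, h₂, h₃⟩ := key w
    rw [h₁]
    exact (IsAffineAt.hasMFDerivAt h₂ h₃).mfderiv
  refine ⟨{
    top := top
    charted := charted
    affine := affine
    isAffineMap_incl := isAffineMap_of_forall_isAffineAt fun y => ?_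
    injective_mfderiv := fun y => ?_
    range_mfderiv := fun y => ?_ }⟩
  · obtain ⟨w, rfl⟩ := e.surjective y
    obtain ⟨A, -, h₂, h₃⟩ := key w
    exact ⟨h₂, A, h₃⟩
  · obtain ⟨w, rfl⟩ := e.surjective y
    have : Function.Injective (mfderiv 𝓘(ℝ, V) 𝓘(ℝ, E) Ψ w : V →L[ℝ] E) := hΨinj w
    rw [← hmf] at this
    exact this
  · obtain ⟨w, rfl⟩ := e.surjective y
    have : (mfderiv 𝓘(ℝ, V) 𝓘(ℝ, E) Ψ w : V →L[ℝ] E).range = D (Ψ w) := hΨrange w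
    rw [← hmf] at this
    exact this

end InducedStructure

end AffineAnosov

/-! ### The main result -/

theorem proposition1p2 (n : ℕ) (M : Type*) [TopologicalSpace M] [T2Space M] [CompactSpace M]
    [ChartedSpace (EuclideanSpace ℝ (Fin n)) M]
    [AffineAnosov.AffineManifold (EuclideanSpace ℝ (Fin n)) M]
    (f : Diffeomorph 𝓘(ℝ, EuclideanSpace ℝ (Fin n)) 𝓘(ℝ, EuclideanSpace ℝ (Fin n)) M M ∞)
    (hf : AffineAnosov.IsAffineMap (EuclideanSpace ℝ (Fin n)) (EuclideanSpace ℝ (Fin n)) f)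
    (Es Eu : ∀ x : M, Submodule ℝ (TangentSpace 𝓘(ℝ, EuclideanSpace ℝ (Fin n)) x))
    (hAnosov : AffineAnosov.IsAnosovSplitting f Es Eu) (x : M) :
    Nonempty (AffineAnosov.InducedAffineStructure Es x) ∧
      ∀ S : AffineAnosov.InducedAffineStructure Es x, S.IsComplete := by
  obtain ⟨Ψ, hinj, hΨ, hΨinj, hΨrange, hΨ0, hleaf⟩ :=
    AffineAnosov.exists_stable_parametrization hAnosov hf x
  have hleaf' : ∀ y, AffineAnosov.JoinedTangentially Es x y ↔ y ∈ range Ψ := by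
    refine fun y => ⟨hleaf y, ?_⟩
    rintro ⟨w, rfl⟩
    have := AffineAnosov.joinedTangentially_of_parametrization hΨ hΨrange w
    rwa [hΨ0] at this
  refine ⟨AffineAnosov.nonempty_inducedAffineStructure hinj hΨ hΨinj hΨrange hleaf', fun S => ?_⟩
  let := S.top
  let := S.charted
  refine AffineAnosov.geodesicallyComplete_of_parametrization
    (i := AffineAnosov.Leaf.incl Es x) Subtype.val_injective S.isAffineMap_incl
    S.injective_mfderiv S.range_mfderiv hΨ hΨrange ?_
  ext y
  rw [← hleaf']
  exact ⟨fun hy => ⟨⟨y, hy⟩, rfl⟩, fun ⟨z, hz⟩ => hz ▸ z.2⟩
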